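/- **Setting.** Let $G$ be $O_N$, or $Sp_N$ with $N$ even, over $\mathbb C$. Put $M=\lfloor N/2\rfloor$; the indices $i,j$ run through $\{-M,\dots,-1,1,\dots,M\}$ if $N=2M$ and through $\{-M,\dots,-1,0,1,\dots,M\}$ if $N=2M+1$. Let $G$ preserve on $\mathbb C^N$ the form $\langle e_i,e_j\rangle=\delta_{i,-j}$ (for $O_N$), respectively $\langle e_i,e_j\rangle=\delta_{i,-j}\operatorname{sgn} i$ (for $Sp_N$), and let $\mathfrak g\subset\mathfrak{gl}_N$ be its Lie algebra. Put $\varepsilon_{ij}=1$, $\eta=\tfrac12$ for $O_N$, and $\varepsilon_{ij}=\operatorname{sgn} i\cdot\operatorname{sgn} j$, $\eta=-\tfrac12$ for $Sp_N$. Let $E_{ij}$ be the matrix units and $F_{ij}=E_{ij}-\varepsilon_{ij}E_{-j,-i}\in\mathfrak g$. For $1\le p\le n$ let $\iota_p:\operatorname{End}(\mathbb C^N)\to\operatorname{End}(\mathbb C^N)^{\otimes n}$ be the embedding as the $p$-th tensor factor. Put $$F_p(u)=-u-\eta+\sum_{i,j}\iota_p(E_{ij})\otimes F_{ji}\in\operatorname{End}(\mathbb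 C^N)^{\otimes n}\otimes \mathrm U(\mathfrak g)[u],\qquad Q_{qp}=\sum_{i,j}\varepsilon_{ij}\,\iota_q(E_{ij})\,\iota_p(E_{-i,-j}).$$ Let $\nu$ be a partition of $n$ with at most $N$ parts. Let $W_\nu$ be the irreducible complex $S_n$-module corresponding to $\nu$, with an $S_n$-invariant inner product. For a standard tableau $T$ of shape $\nu$ let $W_T\subset W_\nu$ be the one-dimensional subspace which, for every $p\le n$, is contained in an irreducible $S_p$-submodule of $W_\nu$ corresponding to the shape of the tableau obtained from $T$ by removing $p+1,\dots,n$. Let $w_T\in W_T$ with $\langle w_T,w_T\rangle=1$, put $$\Phi_T=\frac{\dim W_\nu}{n!}\sum_{\sigma\in S_n}\langle w_T,\sigma w_T\rangle\,\sigma\in\mathbb C[S_n],$$ and let $Y_T\in\operatorname{End}(\mathbb C^N)^{\otimes n}$ be the operator by which $\Phi_T$ acts on $(\mathbb C^N)^{\otimes n}$ through permutations of the tensor factors. Let $c_p$ be the content (column number minus row number) of the box of $T$ occupied by $p$. In $\operatorname{End}(\mathbb C^N)^{\otimes n}\otimes \mathrm U(\mathfrak g)(u)$, where $\mathrm U(\mathfrak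 g)(u)=\mathrm U(\mathfrak g)\otimes\mathbb C(u)$, put $$F_T(u)=(Y_T\otimes1)\cdot\prod_{p=1}^{n}\Bigl(1+\frac{Q_{1p}\otimes1+\dots+Q_{p-1,p}\otimes1}{2u+c_p}\Bigr)F_p(u+c_p),$$ where the non-commuting factors corresponding to $p=1,\dots,n$ are arranged from left to right. **Theorem 2.7.** The rational function of $u$ with values in $\mathrm U(\mathfrak g)$ $$Z_\nu(u)=(\operatorname{tr}^{\otimes n}\otimes\operatorname{id})\bigl(F_T(u)\bigr)\in \mathrm U(\mathfrak g)(u)$$ does not depend on the choice of the standard tableau $T$ of shape $\nu$: any two standard tableaux $T,T'$ of shape $\nu$ (and any unit vectors $w_T\in W_T$, $w_{T'}\in W_{T'}$) give the same element of $\mathrm U(\mathfrak g)(u)$. -/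

import Mathlib

open scoped TensorProduct

noncomputable section

namespace Capelli

attribute [local instance 100] LieRing.ofAssociativeRing

/-! ### The classical groups `O_N`, `Sp_N` and their Lie algebras -/

/-- The complex classical groups: `O N` stands for `O_N`, and `Sp M` for `Sp_N` with `N = 2M`. -/
inductive ClassicalGroup where
  | O (N : ℕ) : ClassicalGroup
  | Sp (M : ℕ) : ClassicalGroup

/-- The dimension `N` of the defining representation. -/
def ClassicalGroup.dim : ClassicalGroup → ℕ
  | .O N => N
  | .Sp M => 2 * M

/-- The index set of size `N`: it is `{-M, …, -1, 1, …, M}` if `N = 2M`, and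
`{-M, …, -1, 0, 1, …, M}` if `N = 2M + 1`. -/
def indexSet (N : ℕ) : Finset ℤ :=
  (Finset.Icc (-((N / 2 : ℕ) : ℤ)) ((N / 2 : ℕ) : ℤ)).filter fun i => i = 0 → Odd N

theorem neg_mem_indexSet {N : ℕ} {i : ℤ} (hi : i ∈ indexSet N) : -i ∈ indexSet N := by
  simp only [indexSet, Finset.mem_filter, Finset.mem_Icc, neg_eq_zero] at hi ⊢
  exact ⟨⟨by linarith [hi.1.2], by linarith [hi.1.1]⟩, hi.2⟩

/-- The index type of the standard basis of `ℂ^N`. -/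
abbrev Idx (G : ClassicalGroup) : Type := ↥(indexSet G.dim)

/-- The index `-i`. -/
def Idx.neg {G : ClassicalGroup} (i : Idx G) : Idx G := ⟨-i.1, neg_mem_indexSet i.2⟩

/-- `ε_{ij}`: it is `1` for `O_N`, and `sgn i · sgn j` for `Sp_N`. -/
def eps : (G : ClassicalGroup) → Idx G → Idx G → ℂ
  | .O _, _, _ => 1
  | .Sp _, i, j => ((i.1.sign * j.1.sign : ℤ) : ℂ)

/-- `η`: it is `1/2` for `so_N`, and `-1/2` for `sp_N`. -/
def eta : ClassicalGroup → ℂ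
  | .O _ => 1 / 2
  | .Sp _ => -(1 / 2)

/-- The Gram matrix of the bilinear form on `ℂ^N`: `⟨e_i, e_j⟩ = δ_{i,-j}` for `O_N`, and
`⟨e_i, e_j⟩ = δ_{i,-j} · sgn i` for `Sp_N`. -/
def gram : (G : ClassicalGroup) → Matrix (Idx G) (Idx G) ℂ
  | .O N => fun (i j : Idx (.O N)) => if i = j.neg then 1 else 0
  | .Sp M => fun (i j : Idx (.Sp M)) => if i = j.neg then ((i.1.sign : ℤ) : ℂ) else 0

/-- `End(ℂ^N)`. -/
abbrev EndN (G : ClassicalGroup) : Type := Matrix (Idx G) (Idx G) ℂ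

/-- The matrix unit `E_{ij}`. -/
def E {G : ClassicalGroup} (i j : Idx G) : EndN G := Matrix.single i j 1

/-- The Lie algebra `𝔤 ⊆ 𝔤𝔩_N` of `G`: the matrices that are skew-adjoint for the form. -/
abbrev LieG (G : ClassicalGroup) : LieSubalgebra ℂ (EndN G) :=
  skewAdjointMatricesLieSubalgebra (gram G)

/-- The universal enveloping algebra `U(𝔤)`. -/
abbrev Ug (G : ClassicalGroup) : Type := UniversalEnvelopingAlgebra ℂ (LieG G)

theorem Idx.neg_neg {G : ClassicalGroup} (i : Idx G) : i.neg.neg = i :=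
  Subtype.ext (_root_.neg_neg i.1)

theorem Idx.sign_mul_self {M : ℕ} (i : Idx (.Sp M)) : i.1.sign * i.1.sign = 1 := by
  have h : i.1 ≠ 0 := fun h0 => by
    have h1 := (Finset.mem_filter.1 i.2).2 h0
    exact Nat.not_odd_iff_even.2 (even_two_mul M) h1
  rcases lt_or_gt_of_ne h with h | h
  · simp [Int.sign_eq_neg_one_of_neg h]
  · simp [Int.sign_eq_one_of_pos h]

theorem F_mem (G : ClassicalGroup) (i j : Idx G) :
    E i j - eps G i j • E j.neg i.neg ∈ LieG G := by
  have hneg : ∀ a b : Idx G, a.neg = b ↔ a = b.neg := fun a b =>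
    ⟨fun h => by rw [← h, Idx.neg_neg], fun h => by rw [h, Idx.neg_neg]⟩
  obtain ⟨s, κ, hs, hκ, hg, he⟩ : ∃ (s : Idx G → ℂ) (κ : ℂ), (∀ a, s a * s a = 1) ∧
      (∀ a, s a.neg = κ * s a) ∧ (∀ a b, gram G a b = if a = b.neg then s a else 0) ∧
      (∀ a b, eps G a b = s a * s b) := by
    cases G with
    | O N => exact ⟨fun _ => 1, 1, by simp, by simp, fun a b => rfl, by simp [eps]⟩
    | Sp M =>
      refine ⟨fun a => ((a.1.sign : ℤ) : ℂ), -1, fun a => ?_, fun a => ?_, fun a b => rfl,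
        fun a b => ?_⟩
      · simpa using congrArg (Int.cast : ℤ → ℂ) (Idx.sign_mul_self a)
      · simp [Idx.neg, Int.sign_neg]
      · simp [eps]
  rw [mem_skewAdjointMatricesLieSubalgebra, mem_skewAdjointMatricesSubmodule]
  change (E i j - eps G i j • E j.neg i.neg).transpose * gram G =
    gram G * (-(E i j - eps G i j • E j.neg i.neg))
  have hinj : ∀ a b : Idx G, a.neg = b.neg ↔ a = b := fun a b => by rw [hneg, Idx.neg_neg]
  ext a b
  have hL : ((E i j - eps G i j • E j.neg i.neg).transpose * gram G) a b =
      (E i j - eps G i j • E j.neg i.neg) b.neg a * s b.neg := by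
    rw [Matrix.mul_apply, Finset.sum_eq_single b.neg]
    · rw [hg, if_pos rfl, Matrix.transpose_apply]
    · intro c _ hc
      rw [hg, if_neg hc, mul_zero]
    · intro h
      exact absurd (Finset.mem_univ _) h
  have hR : (gram G * (-(E i j - eps G i j • E j.neg i.neg))) a b =
      -(s a * (E i j - eps G i j • E j.neg i.neg) a.neg b) := by
    rw [Matrix.mul_apply, Finset.sum_eq_single a.neg]
    · rw [hg, if_pos (Idx.neg_neg a).symm, Matrix.neg_apply, mul_neg]
    · intro c _ hc
      rw [hg, if_neg (fun h => hc ((hneg a c).2 h).symm), zero_mul]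
    · intro h
      exact absurd (Finset.mem_univ _) h
  rw [hL, hR]
  simp only [Matrix.sub_apply, Matrix.smul_apply, E, Matrix.single_apply, smul_eq_mul, he, hinj]
  have h1 : (i = b.neg ∧ j = a) ↔ (j = a ∧ i.neg = b) := by rw [hneg, and_comm]
  have h2 : (j = b ∧ i.neg = a) ↔ (i = a.neg ∧ j = b) := by rw [hneg, and_comm]
  rw [if_congr h1 rfl rfl, if_congr h2 rfl rfl]
  by_cases hA : j = a ∧ i.neg = b
  · obtain ⟨rfl, rfl⟩ := hA
    by_cases hB : i = j.neg ∧ j = i.neg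
    · simp only [and_self, if_true, if_pos hB, Idx.neg_neg]
      linear_combination (-s i) * hs j - s j * hs i
    · simp only [and_self, if_true, if_neg hB, Idx.neg_neg]
      linear_combination (-s i) * hs j
  · by_cases hB : i = a.neg ∧ j = b
    · obtain ⟨rfl, rfl⟩ := hB
      simp only [and_self, if_true, if_neg hA, hκ]
      have h3 := hs a.neg
      rw [hκ] at h3
      have h4 : κ * κ = 1 := by linear_combination h3 - κ * κ * hs a
      linear_combination (-κ * κ * s a) * hs j - s a * h4
    · simp [if_neg hA, if_neg hB]

/-- The generator `F_{ij} = E_{ij} - ε_{ij} E_{-j,-i}` of `𝔤`. -/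
def F (G : ClassicalGroup) (i j : Idx G) : LieG G :=
  ⟨E i j - eps G i j • E j.neg i.neg, F_mem G i j⟩

/-! ### Standard tableaux -/

/-- A standard tableau of shape `ν` with `n` boxes: `box p` is the box occupied by the number
`p + 1`; a box is a pair (row, column), both counted from `0`. -/
structure StandardTableau (n : ℕ) (ν : YoungDiagram) where
  box : Fin n ≃ ↥ν.cells
  row_lt : ∀ p q, (box p).1.1 = (box q).1.1 → (box p).1.2 < (box q).1.2 → p < q
  col_lt : ∀ p q, (box p).1.2 = (box q).1.2 → (box p).1.1 < (box q).1.1 → p < q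

namespace StandardTableau

variable {n : ℕ} {ν : YoungDiagram}

/-- The content (column minus row) of the box occupied by `p + 1`. -/
def content (T : StandardTableau n ν) (p : Fin n) : ℤ := ((T.box p).1.2 : ℤ) - ((T.box p).1.1 : ℤ)

theorem le_of_box_le (T : StandardTableau n ν) (p q : Fin n) (h : (T.box p).1 ≤ (T.box q).1) :
    p ≤ q := by
  have hr : (((T.box p).1.1, (T.box q).1.2) : ℕ × ℕ) ∈ ν.cells :=
    ν.isLowerSet (show (((T.box p).1.1, (T.box q).1.2) : ℕ × ℕ) ≤ (T.box q).1 from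
      ⟨h.1, le_rfl⟩) (T.box q).2
  obtain ⟨r, hr'⟩ := T.box.surjective ⟨_, hr⟩
  have hrv : (T.box r).1 = ((T.box p).1.1, (T.box q).1.2) := congrArg Subtype.val hr'
  have h1 : p ≤ r := by
    rcases h.2.lt_or_eq with hlt | heq
    · exact (T.row_lt p r (by rw [hrv]) (by rw [hrv]; exact hlt)).le
    · exact (T.box.injective (Subtype.ext (by rw [hrv]; exact Prod.ext rfl heq))).le
  have h2 : r ≤ q := by
    rcases h.1.lt_or_eq with hlt | heq
    · exact (T.col_lt r q (by rw [hrv]) (by rw [hrv]; exact hlt)).le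
    · exact (T.box.injective (Subtype.ext (by rw [hrv]; exact Prod.ext heq rfl))).le
  exact h1.trans h2

/-- The shape of the tableau obtained from `T` by removing the numbers `p + 1, …, n`. -/
def shape (T : StandardTableau n ν) (p : ℕ) : YoungDiagram where
  cells := (Finset.univ.filter fun q : Fin n => (q : ℕ) < p).image fun q => (T.box q).1
  isLowerSet := by
    intro c d hdc hc
    obtain ⟨q, hq, rfl⟩ := Finset.mem_image.1 (Finset.mem_coe.1 hc)
    obtain ⟨r, hr⟩ := T.box.surjective ⟨d, ν.isLowerSet hdc (T.box q).2⟩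
    have hrd : (T.box r).1 = d := congrArg Subtype.val hr
    refine Finset.mem_coe.2 (Finset.mem_image.2 ⟨r, ?_, hrd⟩)
    have hle : r ≤ q := T.le_of_box_le r q (by rw [hrd]; exact hdc)
    exact Finset.mem_filter.2
      ⟨Finset.mem_univ _, lt_of_le_of_lt (Fin.le_def.1 hle) (Finset.mem_filter.1 hq).2⟩

end StandardTableau

/-! ### Irreducible modules of the symmetric groups, and Young vectors -/

/-- `ρ` is the irreducible representation of `S_p` that corresponds to the Young diagram `μ`: the
(unique up to isomorphism) irreducible representation which, for a filling `e` of the boxes of `μ`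
by `1, …, p`, has a non-zero vector fixed by the row stabilizer of `e` and a non-zero vector on
which the column stabilizer of `e` acts by the sign character. The choice of `e` is immaterial, as
any two fillings are conjugate under `S_p`. -/
def IsYoungIrrep {p : ℕ} {V : Type*} [AddCommGroup V] [Module ℂ V] (μ : YoungDiagram)
    (ρ : Representation ℂ (Equiv.Perm (Fin p)) V) : Prop :=
  ρ.IsIrreducible ∧ ∃ e : Fin p ≃ ↥μ.cells,
    (∃ v : V, v ≠ 0 ∧ ∀ σ : Equiv.Perm (Fin p),
      (∀ q, (e (σ q)).1.1 = (e q).1.1) → ρ σ v = v) ∧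
    (∃ v : V, v ≠ 0 ∧ ∀ σ : Equiv.Perm (Fin p),
      (∀ q, (e (σ q)).1.2 = (e q).1.2) → ρ σ v = ((Equiv.Perm.sign σ : ℤ) : ℂ) • v)

/-- The standard embedding `S_p → S_n` for `p ≤ n`; the image fixes the numbers `p + 1, …, n`. -/
def permEmbed {p n : ℕ} (h : p ≤ n) : Equiv.Perm (Fin p) →* Equiv.Perm (Fin n) :=
  Equiv.Perm.viaEmbeddingHom (Fin.castLEEmb h)

/-- `w` belongs to the subspace `W_T` of `W`: for every `p`, it lies in an irreducible
`S_p`-submodule of `W` corresponding to the shape of the tableau obtained from `T` by removing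
the numbers `p + 1, …, n`. -/
def IsYoungVector {n : ℕ} {ν : YoungDiagram} {W : Type*} [AddCommGroup W] [Module ℂ W]
    (ρ : Representation ℂ (Equiv.Perm (Fin n)) W) (T : StandardTableau n ν) (w : W) : Prop :=
  ∀ (p : ℕ) (hp : p ≤ n), ∃ U : Subrepresentation (ρ.comp (permEmbed hp)),
    IsYoungIrrep (T.shape p) U.toRepresentation ∧ w ∈ U

/-- The normalized diagonal matrix element
`Φ = (dim W / n!) ∑_σ ⟨w, σ w⟩ σ` in the group ring of `S_n`. -/
def matrixElement {n : ℕ} {W : Type*} [NormedAddCommGroup W] [InnerProductSpace ℂ W]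
    (ρ : Representation ℂ (Equiv.Perm (Fin n)) W) (w : W) :
    MonoidAlgebra ℂ (Equiv.Perm (Fin n)) :=
  ∑ σ : Equiv.Perm (Fin n),
    MonoidAlgebra.single σ
      (((Module.finrank ℂ W : ℂ) / (n.factorial : ℂ)) * inner ℂ w (ρ σ w))

/-! ### The operators -/

/-- `End(ℂ^N)^{⊗ n}`. -/
abbrev EndTensor (G : ClassicalGroup) (n : ℕ) : Type := ⨂[ℂ] _ : Fin n, EndN G

/-- The embedding `ι_p` of `End(ℂ^N)` as the `p`-th tensor factor of `End(ℂ^N)^{⊗ n}`. -/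
def iota (G : ClassicalGroup) {n : ℕ} (p : Fin n) : EndN G →ₐ[ℂ] EndTensor G n :=
  PiTensorProduct.singleAlgHom (A := fun _ : Fin n => EndN G) p

/-- The element of `End(ℂ^N)^{⊗ n}` by which `σ ∈ S_n` acts on `(ℂ^N)^{⊗ n}`: it sends
`⊗_p e_{f(p)}` to `⊗_p e_{f(σ⁻¹ p)}`. -/
def permOp (G : ClassicalGroup) {n : ℕ} (σ : Equiv.Perm (Fin n)) : EndTensor G n :=
  ∑ f : Fin n → Idx G, PiTensorProduct.tprod ℂ fun p => E (f (σ⁻¹ p)) (f p)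

/-- The element of `End(ℂ^N)^{⊗ n}` by which an element of `ℂ[S_n]` acts on `(ℂ^N)^{⊗ n}`. -/
def groupRingOp (G : ClassicalGroup) {n : ℕ} (a : MonoidAlgebra ℂ (Equiv.Perm (Fin n))) :
    EndTensor G n :=
  ∑ σ : Equiv.Perm (Fin n), a.coeff σ • permOp G σ

/-- `Q_{qp}`, for `Q = ∑_{ij} ε_{ij} E_{ij} ⊗ E_{-i,-j}`. -/
def Q (G : ClassicalGroup) {n : ℕ} (q p : Fin n) : EndTensor G n :=
  ∑ i : Idx G, ∑ j : Idx G, eps G i j • (iota G q (E i j) * iota G p (E i.neg j.neg))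

/-- The algebra `U(𝔤)(u)` of rational functions of `u` with values in `U(𝔤)`. -/
abbrev UgRat (G : ClassicalGroup) : Type := Ug G ⊗[ℂ] RatFunc ℂ

/-- The algebra `End(ℂ^N)^{⊗ n} ⊗ U(𝔤)(u)`. -/
abbrev Alg (G : ClassicalGroup) (n : ℕ) : Type := EndTensor G n ⊗[ℂ] UgRat G

/-- A scalar rational function of `u` as an element of `U(𝔤)(u)`. -/
def scalarRat (G : ClassicalGroup) (x : RatFunc ℂ) : UgRat G := 1 ⊗ₜ[ℂ] x

/-- `F_p(x) = -x - η + ∑_{ij} ι_p(E_{ij}) ⊗ F_{ji}`, for a rational function `x` of `u`. -/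
def Fp (G : ClassicalGroup) {n : ℕ} (p : Fin n) (x : RatFunc ℂ) : Alg G n :=
  (1 : EndTensor G n) ⊗ₜ[ℂ] scalarRat G (-x - RatFunc.C (eta G)) +
    ∑ i : Idx G, ∑ j : Idx G,
      iota G p (E i j) ⊗ₜ[ℂ] (UniversalEnvelopingAlgebra.ι ℂ (F G j i) ⊗ₜ[ℂ] (1 : RatFunc ℂ))

/-- `F_T(u) = (Y_T ⊗ 1) ∏_p (1 + (Q_{1p} + … + Q_{p-1,p}) / (2u + c_p)) F_p(u + c_p)`, with the
factors arranged from the left to the right as `p` increases; `Y_T` is the operator of the element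
`Φ` of the group ring. -/
def FT (G : ClassicalGroup) {n : ℕ} {ν : YoungDiagram} (T : StandardTableau n ν)
    (Φ : MonoidAlgebra ℂ (Equiv.Perm (Fin n))) : Alg G n :=
  groupRingOp G Φ ⊗ₜ[ℂ] (1 : UgRat G) *
    (List.ofFn fun p : Fin n =>
      (1 + (∑ q ∈ Finset.univ.filter (fun q : Fin n => q < p), Q G q p) ⊗ₜ[ℂ]
          scalarRat G (2 * RatFunc.X + RatFunc.C (T.content p : ℂ))⁻¹) *
        Fp G p (RatFunc.X + RatFunc.C (T.content p : ℂ))).prod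

/-- `tr^{⊗ n} : End(ℂ^N)^{⊗ n} → ℂ`. -/
def trTensor (G : ClassicalGroup) (n : ℕ) : EndTensor G n →ₗ[ℂ] ℂ :=
  PiTensorProduct.lift
    ((MultilinearMap.mkPiAlgebra ℂ (Fin n) ℂ).compLinearMap fun _ =>
      Matrix.traceLinearMap (Idx G) ℂ ℂ)

/-- `(tr^{⊗ n} ⊗ id)(F_T(u))`, a rational function of `u` with values in `U(𝔤)`. -/
def Z (G : ClassicalGroup) {n : ℕ} {ν : YoungDiagram} (T : StandardTableau n ν)
    (Φ : MonoidAlgebra ℂ (Equiv.Perm (Fin n))) : UgRat G :=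
  TensorProduct.lid ℂ (UgRat G) ((trTensor G n).rTensor (UgRat G) (FT G T Φ))

end Capelli

end

/-!
The function `Z` is a value of an invariant sesquilinear map on the irreducible module `W`, and
Schur's lemma makes such a map constant on unit vectors.

Write `s_{xy}` for the permutation operator of two tensor factors. The permutation operators, the
elements `Q_{qp}` and the matrices `F_p` satisfy a short list of relations (`ReflectionData`; they
are verified for the operators of the theorem in `TensorData` and `tensorData`). They imply the
Yang–Baxter equation and the reflection equation, hence the following intertwining property
(`ReflectionData.intertwiner_mul_prod`). For arbitrary spectral parameters `b_p`, let
`Π(b) = ∏_p (∏_{q < p} (1 + Q_{qp} / (b_q + b_p))) F_p(b_p)`. Then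
`s_{k,k+1} + 1 / (b_{k+1} - b_k)` passes through `Π(b)` at the expense of interchanging `b_k` and
`b_{k+1}`.

Likewise, `(k k+1) - 1 / (a_{k+1} - a_k)` interchanges the eigenvalues of the
Jucys–Murphy elements `∑_{q < p} (q p)` on a common eigenvector (`IsWeight.swap_sub`). These
elements are simultaneously diagonalizable on `W`, so for an equivariant `Ψ : W → A` there is a
linear map `Θ` which sends each eigenvector `x` with eigenvalues `a` to `Ψ(x) Π(u + a)`
(`theta`). Comparison of the two facts shows that `Θ` is again equivariant
(`isEquivariant_theta`). Equivariance in turn makes the Jucys–Murphy elements act on `Θ(x)` from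
the right by the scalars `a_p`, and `Q_{qp} Q_{rp} = s_{qr} Q_{rp}`; this collapses each inner
product over `q` in `Π(u + a)` to `1 + ∑_q Q_{qp} / (2 u + a_p)`
(`ReflectionData.mul_row_eq`, `theta_apply_eq_mul_sumProd`), that is, to the factor in `F_T(u)`.

For `Ψ` take `x ↦ ∑_σ ⟨w, σ x⟩ σ`. The trace of `Θ(x)` is then sesquilinear in `(w, x)`, and
invariant since the trace is cyclic with respect to permutation operators. So its value at `(w, w)`
is the same for all unit vectors `w` (`invariant_sesquilinear_eq`, `trace_matrixCoefficient_eq`).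

It remains to see that a vector of `W_T` is a common eigenvector of the Jucys–Murphy elements, the
eigenvalues being the contents of `T` (`IsYoungVector.isWeight`). On the irreducible module of shape
`μ` the sum of all transpositions is a scalar. It is evaluated on the column antisymmetrization of
a vector fixed by the row stabilizer: only the transpositions within a row or within a column
contribute, and the count gives the sum of the contents of the boxes of `μ`
(`IsYoungIrrep.swapSum_eq`).
-/

open scoped TensorProduct

noncomputable section

namespace Capelli

attribute [local instance 100] LieRing.ofAssociativeRing

/-! ### Reflection data and the intertwining relation -/

/-- Elements of a `K`-algebra indexed by the tensor factors `I`, subject to the relations satisfied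
by the permutation operators `P σ`, the twisted permutations `Q_{qp}`, and the matrices
`G_p = ∑ ι_p(E_{ij}) ⊗ F_{ji}`. These relations are all that the argument uses; `eta` is the
constant `η`. -/
structure ReflectionData (I K A : Type*) [DecidableEq I] [Field K] [Ring A] [Algebra K A] where
  P : Equiv.Perm I →* A
  Q : I → I → A
  G : I → A
  eta : K
  eta_sq : (2 * eta) ^ 2 = 1
  P_mul_Q : ∀ σ q p, P σ * Q q p = Q (σ q) (σ p) * P σ
  P_mul_G : ∀ σ p, P σ * G p = G (σ p) * P σ
  Q_symm : ∀ q p, q ≠ p → Q q p = Q p q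
  Q_mul_Q : ∀ q r p, q ≠ r → r ≠ p → q ≠ p → Q q p * Q r p = P (Equiv.swap q r) * Q r p
  P_mul_Q_self : ∀ q p, q ≠ p → P (Equiv.swap q p) * Q q p = (2 * eta) • Q q p
  Q_commute : ∀ q p r s, q ≠ r → q ≠ s → p ≠ r → p ≠ s → Commute (Q q p) (Q r s)
  G_commute_Q : ∀ r q p, r ≠ q → r ≠ p → Commute (G r) (Q q p)
  Q_mul_G : ∀ q p, q ≠ p → Q q p * G q = -(Q q p * G p)
  G_mul_Q : ∀ q p, q ≠ p → G q * Q q p = -(G p * Q q p)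
  G_bracket : ∀ q p, q ≠ p → G q * G p - G p * G q =
    G p * (P (Equiv.swap q p) - Q q p) - (P (Equiv.swap q p) - Q q p) * G p

namespace ReflectionData

variable {I K A : Type*} [DecidableEq I] [Field K] [Ring A] [Algebra K A]
  (D : ReflectionData I K A)

/-- The factor `1 + Q_{qp} / (b_q + b_p)`, for spectral parameters `b`. -/
def R (b : I → K) (q p : I) : A := 1 + (b q + b p)⁻¹ • D.Q q p

/-- `G_p - x - η`. -/
def F (p : I) (x : K) : A := D.G p - algebraMap K A (x + D.eta)

/-- The product of the factors `1 + Q_{qp} / (b_q + b_p)` over the entries `q` of a list, which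
is read from the right to the left. -/
def row (b : I → K) : List I → I → A
  | [], _ => 1
  | q :: L, p => row b L p * D.R b q p

/-- The product over the entries `p` of a list, read from the right to the left, of the operators
`∏_q (1 + Q_{qp} / (b_q + b_p)) · (G_p - b_p - η)`, where `q` runs through the entries that
precede `p`. -/
def prod (b : I → K) : List I → A
  | [] => 1
  | p :: L => prod b L * (D.row b L p * D.F p (b p))

theorem P_swap_mul_self (x y : I) : D.P (Equiv.swap x y) * D.P (Equiv.swap x y) = 1 := by
  rw [← map_mul, Equiv.swap_mul_self, map_one]

theorem Q_mul_P_self {x y : I} (h : x ≠ y) :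
    D.Q x y * D.P (Equiv.swap x y) = (2 * D.eta) • D.Q x y := by
  have h1 := D.P_mul_Q (Equiv.swap x y) x y
  rw [Equiv.swap_apply_left, Equiv.swap_apply_right, ← D.Q_symm x y h, D.P_mul_Q_self x y h] at h1
  exact h1.symm

theorem commute_P_R {σ : Equiv.Perm I} {q p : I} (b : I → K) (hq : σ q = q) (hp : σ p = p) :
    Commute (D.P σ) (D.R b q p) := by
  have h : Commute (D.P σ) (D.Q q p) := by
    have := D.P_mul_Q σ q p
    rwa [hq, hp] at this
  exact (Commute.one_right _).add_right (h.smul_right _)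

theorem commute_P_F {σ : Equiv.Perm I} {p : I} (x : K) (hp : σ p = p) :
    Commute (D.P σ) (D.F p x) := by
  have h : Commute (D.P σ) (D.G p) := by
    have := D.P_mul_G σ p
    rwa [hp] at this
  exact h.sub_right (Algebra.commutes _ _).symm

theorem commute_P_row {σ : Equiv.Perm I} {p : I} (b : I → K) (hp : σ p = p) (L : List I)
    (hL : ∀ q ∈ L, σ q = q) : Commute (D.P σ) (D.row b L p) := by
  induction L with
  | nil => exact Commute.one_right _
  | cons q L ih =>
    exact (ih fun r hr => hL r (List.mem_cons_of_mem _ hr)).mul_right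
      (D.commute_P_R b (hL q List.mem_cons_self) hp)

theorem commute_P_prod {σ : Equiv.Perm I} (b : I → K) (L : List I)
    (hL : ∀ q ∈ L, σ q = q) : Commute (D.P σ) (D.prod b L) := by
  induction L with
  | nil => exact Commute.one_right _
  | cons p L ih =>
    have hp := hL p List.mem_cons_self
    have hL' : ∀ q ∈ L, σ q = q := fun r hr => hL r (List.mem_cons_of_mem _ hr)
    exact (ih hL').mul_right ((D.commute_P_row b hp L hL').mul_right (D.commute_P_F _ hp))

theorem R_commute {q p r s : I} (b b' : I → K) (h1 : q ≠ r) (h2 : q ≠ s) (h3 : p ≠ r)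
    (h4 : p ≠ s) : Commute (D.R b q p) (D.R b' r s) :=
  (Commute.one_left _).add_left
    (((Commute.one_right _).add_right ((D.Q_commute q p r s h1 h2 h3 h4).smul_right _)).smul_left _)

theorem F_commute_R {p q r : I} (x : K) (b : I → K) (h1 : p ≠ q) (h2 : p ≠ r) :
    Commute (D.F p x) (D.R b q r) :=
  ((Commute.one_right _).add_right ((D.G_commute_Q p q r h1 h2).smul_right _)).sub_left
    (Algebra.commutes _ _)

theorem F_commute_row {p r : I} (x : K) (b : I → K) (h : p ≠ r) (L : List I) (hL : p ∉ L) :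
    Commute (D.F p x) (D.row b L r) := by
  induction L with
  | nil => exact Commute.one_right _
  | cons q L ih =>
    rw [List.mem_cons, not_or] at hL
    exact (ih hL.2).mul_right (D.F_commute_R x b hL.1 h)

theorem R_commute_row {q p r : I} (b b' : I → K) (hqr : q ≠ r) (hpr : p ≠ r) (L : List I)
    (hq : q ∉ L) (hp : p ∉ L) : Commute (D.R b q p) (D.row b' L r) := by
  induction L with
  | nil => exact Commute.one_right _
  | cons s L ih =>
    rw [List.mem_cons, not_or] at hq hp
    exact (ih hq.2 hp.2).mul_right (D.R_commute b b' hq.1 hqr hp.1 hpr)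

theorem row_congr {b b' : I → K} (L : List I) (p : I) (hp : b p = b' p)
    (hL : ∀ q ∈ L, b q = b' q) : D.row b L p = D.row b' L p := by
  induction L with
  | nil => rfl
  | cons q L ih =>
    rw [row, row, ih fun r hr => hL r (List.mem_cons_of_mem _ hr), R, R, hp,
      hL q List.mem_cons_self]

theorem prod_congr {b b' : I → K} (L : List I) (hL : ∀ q ∈ L, b q = b' q) :
    D.prod b L = D.prod b' L := by
  induction L with
  | nil => rfl
  | cons p L ih =>
    have h : ∀ q ∈ L, b q = b' q := fun r hr => hL r (List.mem_cons_of_mem _ hr)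
    have hp := hL p List.mem_cons_self
    rw [prod, prod, ih h, D.row_congr L p hp h, hp]

/-- The operator `(x y) + 1 / (b_y - b_x)`, which interchanges the spectral parameters of the
tensor factors `x` and `y`. -/
def intertwiner (b : I → K) (x y : I) : A :=
  D.P (Equiv.swap x y) + algebraMap K A (b y - b x)⁻¹

theorem commute_intertwiner {c : A} (b : I → K) {x y : I}
    (h : Commute (D.P (Equiv.swap x y)) c) : Commute (D.intertwiner b x y) c :=
  h.add_left (Algebra.commutes _ _)

/-- The Yang–Baxter equation for `P` and two factors `Q_{qx}`, `Q_{qy}`. -/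
theorem intertwiner_mul_R_mul_R {x y q : I} (b : I → K) (hxy : x ≠ y) (hqx : q ≠ x) (hqy : q ≠ y)
    (hb : b x ≠ b y) (h1 : b q + b x ≠ 0) (h2 : b q + b y ≠ 0) :
    D.intertwiner b x y * (D.R b q x * D.R b q y) =
      D.R (b ∘ Equiv.swap x y) q x * D.R (b ∘ Equiv.swap x y) q y * D.intertwiner b x y := by
  have hs := D.P_mul_Q (Equiv.swap x y) q x
  have hs' := D.P_mul_Q (Equiv.swap x y) q y
  rw [Equiv.swap_apply_of_ne_of_ne hqx hqy, Equiv.swap_apply_left] at hs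
  rw [Equiv.swap_apply_of_ne_of_ne hqx hqy, Equiv.swap_apply_right] at hs'
  have hAB : D.Q q x * D.Q q y = D.P (Equiv.swap x y) * D.Q q y := by
    rw [D.Q_symm q x hqx, D.Q_symm q y hqy]
    exact D.Q_mul_Q x y q hxy hqy.symm hqx.symm
  have hBA : D.Q q y * D.Q q x = D.P (Equiv.swap x y) * D.Q q x := by
    rw [D.Q_symm q x hqx, D.Q_symm q y hqy, Equiv.swap_comm]
    exact D.Q_mul_Q y x q hxy.symm hqx.symm hqy.symm
  have hss := D.P_swap_mul_self x y
  have hby : b y - b x ≠ 0 := sub_ne_zero.2 hb.symm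
  simp only [intertwiner, R, Function.comp, Equiv.swap_apply_of_ne_of_ne hqx hqy,
    Equiv.swap_apply_left, Equiv.swap_apply_right]
  generalize D.P (Equiv.swap x y) = s at *
  generalize D.Q q x = a at *
  generalize D.Q q y = c at *
  have hssa : s * (s * a) = a := by rw [← mul_assoc, hss, one_mul]
  have hssc : s * (s * c) = c := by rw [← mul_assoc, hss, one_mul]
  have hcs : c * s = s * a := hs.symm
  have has : a * s = s * c := hs'.symm
  simp only [Algebra.algebraMap_eq_smul_one, mul_add, add_mul, mul_one, one_mul, smul_mul_assoc,
    mul_smul_comm, smul_add, hAB, hcs, has, hssa, hssc, mul_assoc]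
  match_scalars <;> field_simp <;> ring

/-- The reflection equation. -/
theorem intertwiner_mul_F_mul_R_mul_F {x y : I} (b : I → K) (hxy : x ≠ y)
    (hb : b x ≠ b y) (h : b x + b y ≠ 0) :
    D.intertwiner b x y * (D.F x (b x) * D.R b x y * D.F y (b y)) =
      D.F x (b y) * D.R (b ∘ Equiv.swap x y) x y * D.F y (b x) * D.intertwiner b x y := by
  have hs := D.P_mul_G (Equiv.swap x y) x
  have hs' := D.P_mul_G (Equiv.swap x y) y
  rw [Equiv.swap_apply_left] at hs
  rw [Equiv.swap_apply_right] at hs'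
  have hss := D.P_swap_mul_self x y
  have hsQ := D.P_mul_Q_self x y hxy
  have hQs := D.Q_mul_P_self hxy
  have hQG := D.Q_mul_G x y hxy
  have hGQ := D.G_mul_Q x y hxy
  have hGG := D.G_bracket x y hxy
  have hby : b y - b x ≠ 0 := sub_ne_zero.2 hb.symm
  have h' : b y + b x ≠ 0 := by rwa [add_comm]
  simp only [intertwiner, R, F, Function.comp, Equiv.swap_apply_left, Equiv.swap_apply_right]
  generalize D.P (Equiv.swap x y) = s at *
  generalize D.Q x y = q at *
  generalize D.G x = g at *
  generalize D.G y = f at *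
  have hgf : g * f = f * g + (f * (s - q) - (s - q) * f) := by rw [← hGG, add_sub_cancel]
  have hfs : f * s = s * g := hs.symm
  have hgs : g * s = s * f := hs'.symm
  have hfsz (z : A) : f * (s * z) = s * (g * z) := by rw [← mul_assoc, hfs, mul_assoc]
  have hqs (z : A) : q * (s * z) = (2 * D.eta) • (q * z) := by
    rw [← mul_assoc, hQs, smul_mul_assoc]
  have hsq (z : A) : s * (q * z) = (2 * D.eta) • (q * z) := by
    rw [← mul_assoc, hsQ, smul_mul_assoc]
  have hsfq : s * (f * q) = -((2 * D.eta) • (f * q)) := by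
    rw [← mul_assoc, hs', mul_assoc, hsQ, mul_smul_comm, hGQ, smul_neg]
  have hsfqz (z : A) : s * (f * (q * z)) = -((2 * D.eta) • (f * (q * z))) := by
    have := congrArg (· * z) hsfq
    simpa only [mul_assoc, neg_mul, smul_mul_assoc] using this
  have hssz (z : A) : s * (s * z) = z := by rw [← mul_assoc, hss, one_mul]
  -- every word is brought to the form `s^ε w`, where `w` ends in `f` after a factor `q`
  simp only [Algebra.algebraMap_eq_smul_one, mul_add, add_mul, mul_sub, sub_mul, mul_one, one_mul,
    smul_mul_assoc, mul_smul_comm, smul_add, smul_sub, mul_assoc, hgf, hfs, hgs, hfsz,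
    hGQ, hQG, hqs, hssz, hsQ, hQs, hsq, hsfq, hsfqz, mul_neg, neg_mul, smul_neg]
  match_scalars <;> field_simp <;>
    first | ring1 | linear_combination (b x ^ 2 - b y ^ 2) * D.eta_sq

/-- The intertwiner exchanges the rows of `x` and `y`, by the Yang–Baxter equation for each `q`. -/
theorem intertwiner_mul_row_mul_row {x y : I} (b : I → K) (hxy : x ≠ y) (hb : b x ≠ b y)
    (hne : ∀ q r, b q + b r ≠ 0) (L : List I) (hL : L.Nodup) (hx : x ∉ L) (hy : y ∉ L) :
    D.intertwiner b x y * (D.row b L x * D.row b L y) =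
      D.row (b ∘ Equiv.swap x y) L x * D.row (b ∘ Equiv.swap x y) L y * D.intertwiner b x y := by
  induction L with
  | nil => simp [row]
  | cons q L ih =>
    rw [List.mem_cons, not_or] at hx hy
    rw [List.nodup_cons] at hL
    have key (c c' : I → K) : D.row c (q :: L) x * D.row c (q :: L) y =
        D.row c L x * D.row c L y * (D.R c q x * D.R c q y) := by
      have h := (D.R_commute_row c c (p := x) (q := q) (Ne.symm hy.1) hxy L hL.1 hx.2).eq
      rw [row, row, mul_assoc, ← mul_assoc (D.R c q x), h, mul_assoc, ← mul_assoc, ← mul_assoc,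
        mul_assoc (D.row c L x * D.row c L y)]
    rw [key b b, key _ b, ← mul_assoc, ih hL.2 hx.2 hy.2, mul_assoc,
      D.intertwiner_mul_R_mul_R b hxy (Ne.symm hx.1) (Ne.symm hy.1) hb (hne _ _) (hne _ _),
      mul_assoc, mul_assoc, mul_assoc, mul_assoc, mul_assoc]

/-- The intertwiner passes through the row of a later factor `p`, by the Yang–Baxter equation for
`x`, `y`, `p`. -/
theorem intertwiner_mul_row {x y p : I} (b : I → K) (hxy : x ≠ y) (hb : b x ≠ b y)
    (hne : ∀ q r, b q + b r ≠ 0) (hpx : p ≠ x) (hpy : p ≠ y) (L L' : List I)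
    (hL : (L' ++ y :: x :: L).Nodup) :
    D.intertwiner b x y * D.row b (L' ++ y :: x :: L) p =
      D.row (b ∘ Equiv.swap x y) (L' ++ y :: x :: L) p * D.intertwiner b x y := by
  have hfix {q : I} (h1 : q ≠ x) (h2 : q ≠ y) : b q = (b ∘ Equiv.swap x y) q := by
    rw [Function.comp, Equiv.swap_apply_of_ne_of_ne h1 h2]
  have hp := Equiv.swap_apply_of_ne_of_ne hpx hpy
  have hbp := hfix hpx hpy
  induction L' with
  | nil =>
    rw [List.nil_append] at hL ⊢
    obtain ⟨⟨-, hy⟩, hx, hN⟩ : (y ≠ x ∧ y ∉ L) ∧ x ∉ L ∧ L.Nodup := by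
      simpa using hL
    have hne' {q : I} (hq : q ∈ L) : q ≠ x ∧ q ≠ y :=
      ⟨fun h => hx (h ▸ hq), fun h => hy (h ▸ hq)⟩
    have h1 : Commute (D.intertwiner b x y) (D.row b L p) :=
      D.commute_intertwiner b (D.commute_P_row b hp L fun q hq =>
        Equiv.swap_apply_of_ne_of_ne (hne' hq).1 (hne' hq).2)
    have h2 := D.intertwiner_mul_R_mul_R b hxy hpx hpy hb (hne _ _) (hne _ _)
    have hflip (c : I → K) {q : I} (hq : p ≠ q) : D.R c q p = D.R c p q := by
      rw [R, R, D.Q_symm q p hq.symm, add_comm (c q)]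
    rw [row, row, row, row, ← D.row_congr L p hbp fun q hq => hfix (hne' hq).1 (hne' hq).2,
      hflip b hpx, hflip b hpy, hflip _ hpx, hflip _ hpy, mul_assoc, ← mul_assoc, h1.eq, mul_assoc,
      h2, mul_assoc, mul_assoc, mul_assoc]
  | cons q L' ih =>
    rw [List.cons_append, List.nodup_cons] at hL
    have hq : q ≠ x ∧ q ≠ y := by
      constructor <;> rintro rfl <;> simp at hL
    have h1 : Commute (D.intertwiner b x y) (D.R b q p) :=
      D.commute_intertwiner b (D.commute_P_R b (Equiv.swap_apply_of_ne_of_ne hq.1 hq.2) hp)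
    have h2 : D.R (b ∘ Equiv.swap x y) q p = D.R b q p := by
      rw [R, R, ← hbp, ← hfix hq.1 hq.2]
    rw [List.cons_append, row, row, h2, ← mul_assoc, ih hL.2, mul_assoc, h1.eq, mul_assoc]

/-- The ordered product intertwines: `(x y) + 1 / (b_y - b_x)` passes through it at the expense of
interchanging the parameters of two consecutive factors `x`, `y`. -/
theorem intertwiner_mul_prod {x y : I} (b : I → K) (hb : b x ≠ b y)
    (hne : ∀ q r, b q + b r ≠ 0) (L L' : List I) (hL : (L' ++ y :: x :: L).Nodup) :
    D.intertwiner b x y * D.prod b (L' ++ y :: x :: L) =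
      D.prod (b ∘ Equiv.swap x y) (L' ++ y :: x :: L) * D.intertwiner b x y := by
  have hfix {q : I} (h1 : q ≠ x) (h2 : q ≠ y) : b q = (b ∘ Equiv.swap x y) q := by
    rw [Function.comp, Equiv.swap_apply_of_ne_of_ne h1 h2]
  induction L' with
  | nil =>
    rw [List.nil_append] at hL ⊢
    obtain ⟨⟨hyx, hy⟩, hx, hN⟩ : (y ≠ x ∧ y ∉ L) ∧ x ∉ L ∧ L.Nodup := by
      simpa using hL
    have hne' {q : I} (hq : q ∈ L) : q ≠ x ∧ q ≠ y :=
      ⟨fun h => hx (h ▸ hq), fun h => hy (h ▸ hq)⟩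
    have h1 : Commute (D.intertwiner b x y) (D.prod b L) :=
      D.commute_intertwiner b (D.commute_P_prod b L fun q hq =>
        Equiv.swap_apply_of_ne_of_ne (hne' hq).1 (hne' hq).2)
    have key (c : I → K) : D.row c L x * D.F x (c x) * (D.row c (x :: L) y * D.F y (c y)) =
        D.row c L x * D.row c L y * (D.F x (c x) * D.R c x y * D.F y (c y)) := by
      have h := (D.F_commute_row (c x) c hyx.symm L hx).eq
      rw [row, mul_assoc, ← mul_assoc (D.F x (c x)), ← mul_assoc (D.F x (c x)), h]
      simp only [mul_assoc]
    have h2 := D.intertwiner_mul_row_mul_row b hyx.symm hb hne L hN hx hy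
    have h3 := D.intertwiner_mul_F_mul_R_mul_F b hyx.symm hb (hne _ _)
    have e1 : (b ∘ Equiv.swap x y) x = b y := by simp
    have e2 : (b ∘ Equiv.swap x y) y = b x := by simp
    rw [prod, prod, prod, prod, ← D.prod_congr L fun q hq => hfix (hne' hq).1 (hne' hq).2,
      mul_assoc (D.prod b L), mul_assoc (D.prod b L), key, key, ← mul_assoc, h1.eq, mul_assoc,
      ← mul_assoc (D.intertwiner b x y), h2, mul_assoc _ (D.intertwiner b x y), h3, e1, e2]
    simp only [mul_assoc]
  | cons q L' ih =>
    rw [List.cons_append, List.nodup_cons] at hL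
    have hq : q ≠ x ∧ q ≠ y := by
      constructor <;> rintro rfl <;> simp at hL
    have h1 : Commute (D.intertwiner b x y) (D.F q (b q)) :=
      D.commute_intertwiner b (D.commute_P_F _ (Equiv.swap_apply_of_ne_of_ne hq.1 hq.2))
    have hxy : x ≠ y := by
      rintro rfl
      exact hb rfl
    rw [List.cons_append, prod, prod, ← hfix hq.1 hq.2, ← mul_assoc, ih hL.2, mul_assoc,
      ← mul_assoc (D.intertwiner b x y),
      D.intertwiner_mul_row b hxy hb hne hq.1 hq.2 L L' hL.2, mul_assoc (D.row _ _ _), h1.eq]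
    simp only [mul_assoc]

end ReflectionData

/-! ### Irreducible representations -/

section Irreducible

variable {Γ V : Type*} [Group Γ] [AddCommGroup V] [Module ℂ V] {ρ : Representation ℂ Γ V}

theorem eq_top_of_invariant (h : ρ.IsIrreducible) (p : Submodule ℂ V)
    (hp : ∀ g, ∀ v ∈ p, ρ g v ∈ p) {v : V} (hv : v ∈ p) (hv0 : v ≠ 0) : p = ⊤ := by
  have := h
  let U : Subrepresentation ρ := ⟨p, fun g v hv => hp g v hv⟩
  have hU : U ≠ ⊥ := by
    intro h
    have : v ∈ U := hv
    rw [h] at this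
    exact hv0 this
  have hU' := (eq_bot_or_eq_top U).resolve_left hU
  exact congrArg Subrepresentation.toSubmodule hU'

theorem span_orbit_eq_top (h : ρ.IsIrreducible) {v : V} (hv : v ≠ 0) :
    Submodule.span ℂ (Set.range fun g => ρ g v) = ⊤ := by
  refine eq_top_of_invariant h _ (fun g x hx => ?_) (v := v)
    (Submodule.subset_span ⟨1, by simp⟩) hv
  induction hx using Submodule.span_induction with
  | mem x hx =>
    obtain ⟨g', rfl⟩ := hx
    exact Submodule.subset_span ⟨g * g', by simp⟩
  | zero => simp
  | add x y _ _ hx hy => rw [map_add]; exact add_mem hx hy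
  | smul c x _ hx => rw [map_smul]; exact Submodule.smul_mem _ _ hx

/-- An eigenvalue of an operator that commutes with an irreducible representation is the only
one. -/
theorem apply_eq_smul_of_commute (h : ρ.IsIrreducible) (f : V →ₗ[ℂ] V)
    (hf : ∀ g x, f (ρ g x) = ρ g (f x)) {c : ℂ} {v : V} (hv : v ≠ 0) (hfv : f v = c • v) (x : V) :
    f x = c • x := by
  have h1 : LinearMap.ker (f - c • LinearMap.id) = ⊤ := by
    refine eq_top_of_invariant h _ (fun g y hy => ?_) (v := v) (by simp [hfv]) hv
    simp only [LinearMap.mem_ker, LinearMap.sub_apply, LinearMap.smul_apply, LinearMap.id_apply,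
      sub_eq_zero] at hy ⊢
    rw [hf, hy, map_smul]
  have h2 : x ∈ LinearMap.ker (f - c • LinearMap.id) := h1 ▸ Submodule.mem_top
  simpa [sub_eq_zero] using h2

theorem finiteDimensional_of_isIrreducible [Finite Γ] (h : ρ.IsIrreducible) :
    FiniteDimensional ℂ V := by
  by_cases h0 : ∃ v : V, v ≠ 0
  · obtain ⟨v, hv⟩ := h0
    exact ⟨⟨(Set.finite_range fun g => ρ g v).toFinset, by
      rw [Set.Finite.coe_toFinset, span_orbit_eq_top h hv]⟩⟩
  · push Not at h0
    have : Subsingleton V := ⟨fun a b => by rw [h0 a, h0 b]⟩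
    infer_instance

end Irreducible

/-! ### Invariant sesquilinear maps -/

section Schur

variable {Γ W U : Type*} [Group Γ] [NormedAddCommGroup W] [InnerProductSpace ℂ W]
  [AddCommGroup U] [Module ℂ U] {ρ : Representation ℂ Γ W}

theorem inner_right_comm (hinv : ∀ g x y, inner ℂ (ρ g x) (ρ g y) = inner ℂ x y) (g : Γ)
    (x y : W) : inner ℂ (ρ g x) y = inner ℂ x (ρ g⁻¹ y) := by
  rw [← hinv g⁻¹ (ρ g x) y, ← Module.End.mul_apply, ← map_mul, inv_mul_cancel, map_one,
    Module.End.one_apply]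

variable [Fintype Γ]

/-- The operator `x ↦ ∑_g ⟨g v, x⟩ g v`. -/
def orbitOperator (ρ : Representation ℂ Γ W) (v : W) : W →ₗ[ℂ] W :=
  ∑ g : Γ, (innerₛₗ ℂ (ρ g v)).smulRight (ρ g v)

theorem orbitOperator_apply (v x : W) :
    orbitOperator ρ v x = ∑ g : Γ, inner ℂ (ρ g v) x • ρ g v := by
  simp [orbitOperator]

theorem orbitOperator_comm (hinv : ∀ g x y, inner ℂ (ρ g x) (ρ g y) = inner ℂ x y) (v : W) (g : Γ)
    (x : W) : orbitOperator ρ v (ρ g x) = ρ g (orbitOperator ρ v x) := by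
  rw [orbitOperator_apply, orbitOperator_apply, map_sum]
  refine (Fintype.sum_equiv (Equiv.mulLeft g) _ _ fun h => ?_).symm
  rw [Equiv.coe_mulLeft, map_mul, Module.End.mul_apply, map_smul, hinv]

theorem inner_orbitOperator (v x : W) :
    inner ℂ x (orbitOperator ρ v x) = ((∑ g : Γ, ‖inner ℂ (ρ g v) x‖ ^ 2 : ℝ) : ℂ) := by
  rw [orbitOperator_apply, inner_sum, Complex.ofReal_sum]
  refine Finset.sum_congr rfl fun g _ => ?_
  rw [inner_smul_right, ← inner_conj_symm x, Complex.mul_conj, Complex.normSq_eq_norm_sq]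

/-- The orbit operator is a scalar, which is read off at a unit vector `w`. -/
theorem orbitOperator_eq_smul [FiniteDimensional ℂ W] (h : ρ.IsIrreducible)
    (hinv : ∀ g x y, inner ℂ (ρ g x) (ρ g y) = inner ℂ x y)
    {v w : W} (hw : inner ℂ w w = (1 : ℂ)) (x : W) :
    orbitOperator ρ v x = inner ℂ w (orbitOperator ρ v w) • x := by
  have hw0 : w ≠ 0 := by
    rintro rfl
    simp at hw
  have : Nontrivial W := ⟨w, 0, hw0⟩
  obtain ⟨c, hc⟩ := Module.End.exists_eigenvalue (orbitOperator ρ v)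
  obtain ⟨y, hy⟩ := hc.exists_hasEigenvector
  have hsm := apply_eq_smul_of_commute h _ (orbitOperator_comm hinv v) hy.2 hy.apply_eq_smul
  rw [hsm w, inner_smul_right, hw, mul_one, hsm x]

/-- By Schur's lemma, an invariant sesquilinear map on an irreducible unitary representation takes
the same value at `(w, w)` for all unit vectors `w`. -/
theorem invariant_sesquilinear_eq [FiniteDimensional ℂ W] (h : ρ.IsIrreducible)
    (hinv : ∀ g x y, inner ℂ (ρ g x) (ρ g y) = inner ℂ x y)
    (B : W →ₗ⋆[ℂ] W →ₗ[ℂ] U) (hB : ∀ g x y, B (ρ g x) (ρ g y) = B x y) {v w : W}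
    (hv : inner ℂ v v = (1 : ℂ)) (hw : inner ℂ w w = (1 : ℂ)) : B v v = B w w := by
  set c := ∑ g : Γ, ‖inner ℂ (ρ g v) w‖ ^ 2 with hc
  have hLv (x : W) : orbitOperator ρ v x = (c : ℂ) • x := by
    rw [orbitOperator_eq_smul h hinv hw, inner_orbitOperator]
  have hLw (x : W) : orbitOperator ρ w x = (c : ℂ) • x := by
    rw [orbitOperator_eq_smul h hinv hv, inner_orbitOperator]
    congr 2
    refine Fintype.sum_equiv (Equiv.inv Γ) _ _ fun g => ?_
    rw [inner_right_comm hinv, Equiv.inv_apply, norm_inner_symm]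
  have hc0 : (c : ℂ) ≠ 0 := by
    have h1 : inner ℂ v (orbitOperator ρ v v) = (c : ℂ) := by
      rw [hLv, inner_smul_right, hv, mul_one]
    rw [inner_orbitOperator] at h1
    rw [← h1, Complex.ofReal_ne_zero]
    have h2 : (0 : ℝ) < ‖inner ℂ (ρ 1 v) v‖ ^ 2 := by
      rw [map_one, Module.End.one_apply, hv, norm_one, one_pow]
      exact one_pos
    exact (h2.trans_le (Finset.single_le_sum (f := fun g => ‖inner ℂ (ρ g v) v‖ ^ 2)
      (fun g _ => by positivity) (Finset.mem_univ 1))).ne'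
  have h1 : B w (orbitOperator ρ v w) = B (orbitOperator ρ w v) v := by
    rw [orbitOperator_apply, orbitOperator_apply, map_sum, map_sum, LinearMap.sum_apply]
    refine Fintype.sum_equiv (Equiv.inv Γ) _ _ fun g => ?_
    rw [map_smul, map_smulₛₗ, LinearMap.smul_apply, inner_conj_symm, inner_right_comm hinv,
      Equiv.inv_apply, ← hB g (ρ g⁻¹ w) v, ← Module.End.mul_apply, ← map_mul, mul_inv_cancel,
      map_one, Module.End.one_apply]
  rw [hLv, hLw, map_smul, map_smulₛₗ, LinearMap.smul_apply, Complex.conj_ofReal] at h1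
  exact (smul_right_injective U hc0 h1).symm

end Schur

/-! ### Jucys–Murphy elements and their eigenvectors -/

section JucysMurphy

variable {n : ℕ} {V : Type*} [AddCommGroup V] [Module ℂ V]

/-- The action of the Jucys–Murphy element `∑_{q < p} (q p)`. -/
def jucysMurphy (ρ : Representation ℂ (Equiv.Perm (Fin n)) V) (p : Fin n) : V →ₗ[ℂ] V :=
  ∑ q with q < p, ρ (Equiv.swap q p)

/-- `x` is a common eigenvector of the Jucys–Murphy elements, with eigenvalues `a`; the zero vector
is allowed. -/
def IsWeight (ρ : Representation ℂ (Equiv.Perm (Fin n)) V) (a : Fin n → ℂ) (x : V) : Prop :=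
  ∀ p, jucysMurphy ρ p x = a p • x

variable {ρ : Representation ℂ (Equiv.Perm (Fin n)) V}

theorem jucysMurphy_apply (p : Fin n) (x : V) :
    jucysMurphy ρ p x = ∑ q with q < p, ρ (Equiv.swap q p) x := by
  simp [jucysMurphy]

theorem rho_swap_swap (k l : Fin n) (x : V) :
    ρ (Equiv.swap k l) (ρ (Equiv.swap k l) x) = x := by
  rw [← Module.End.mul_apply, ← map_mul, Equiv.swap_mul_self, map_one, Module.End.one_apply]

theorem jucysMurphy_apply_rho {σ : Equiv.Perm (Fin n)} {p : Fin n} (hp : σ p = p)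
    (hσ : ∀ q, σ q < p ↔ q < p) (x : V) :
    jucysMurphy ρ p (ρ σ x) = ρ σ (jucysMurphy ρ p x) := by
  rw [jucysMurphy_apply, jucysMurphy_apply, map_sum]
  symm
  refine Finset.sum_equiv σ (fun q => by simp [hσ]) fun q _ => ?_
  rw [← Module.End.mul_apply, ← map_mul, ← Module.End.mul_apply, ← map_mul,
    Equiv.mul_swap_eq_swap_mul, hp]

theorem jucysMurphy_commute (p r : Fin n) : Commute (jucysMurphy ρ p) (jucysMurphy ρ r) := by
  wlog h : p < r generalizing p r
  · rcases (not_lt.1 h).lt_or_eq with h | rfl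
    · exact (this r p h).symm
    · exact Commute.refl _
  refine Commute.sum_left _ _ _ fun q hq => ?_
  have hq' : q < p := (Finset.mem_filter.1 hq).2
  refine LinearMap.ext fun x => ?_
  refine (jucysMurphy_apply_rho (Equiv.swap_apply_of_ne_of_ne (hq'.trans h).ne' h.ne')
    (fun s => ?_) x).symm
  rcases eq_or_ne s q with rfl | h1
  · simp [h, hq'.trans h]
  rcases eq_or_ne s p with rfl | h2
  · simp [h, hq'.trans h]
  rw [Equiv.swap_apply_of_ne_of_ne h1 h2]

/-- The relation `J_l (k l) = (k l) J_k + 1` for neighbours `k`, `l`. -/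
theorem jucysMurphy_swap_succ {k l : Fin n} (hkl : (k : ℕ) + 1 = l) (x : V) :
    jucysMurphy ρ l (ρ (Equiv.swap k l) x) =
      ρ (Equiv.swap k l) (jucysMurphy ρ k x) + x := by
  have hk : k < l := by rw [Fin.lt_def]; omega
  have hset : (Finset.univ.filter fun q : Fin n => q < l) =
      insert k (Finset.univ.filter fun q : Fin n => q < k) := by
    ext q
    simp only [Finset.mem_filter, Finset.mem_univ, true_and, Finset.mem_insert, Fin.lt_def,
      Fin.ext_iff]
    omega
  rw [jucysMurphy_apply, hset, Finset.sum_insert (by simp), rho_swap_swap, add_comm,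
    jucysMurphy_apply, map_sum]
  congr 1
  refine Finset.sum_congr rfl fun q hq => ?_
  have hq' : q < k := (Finset.mem_filter.1 hq).2
  rw [← Module.End.mul_apply, ← map_mul, ← Module.End.mul_apply, ← map_mul,
    Equiv.mul_swap_eq_swap_mul (Equiv.swap k l), Equiv.swap_apply_left,
    Equiv.swap_apply_of_ne_of_ne hq'.ne (hq'.trans hk).ne]

/-- The degenerate affine Hecke algebra relations turn an eigenvector into one for the interchanged
eigenvalues. -/
theorem IsWeight.swap_sub {a : Fin n → ℂ} {x : V} (hx : IsWeight ρ a x) {k l : Fin n}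
    (hkl : (k : ℕ) + 1 = l) (ha : a k ≠ a l) :
    IsWeight ρ (a ∘ Equiv.swap k l) (ρ (Equiv.swap k l) x - (a l - a k)⁻¹ • x) := by
  have hd : a l - a k ≠ 0 := sub_ne_zero.2 ha.symm
  have hk : k < l := by rw [Fin.lt_def]; omega
  intro p
  rw [map_sub, map_smul, hx p, Function.comp]
  rcases eq_or_ne p k with rfl | h1
  · have h := jucysMurphy_swap_succ (ρ := ρ) hkl (ρ (Equiv.swap p l) x)
    rw [rho_swap_swap, hx l] at h
    have h' := congrArg (ρ (Equiv.swap p l)) h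
    rw [map_add, rho_swap_swap, rho_swap_swap, map_smul, ← sub_eq_iff_eq_add] at h'
    rw [← h', Equiv.swap_apply_left]
    match_scalars <;> field_simp
    ring
  rcases eq_or_ne p l with rfl | h2
  · rw [jucysMurphy_swap_succ hkl, hx k, map_smul, Equiv.swap_apply_right]
    match_scalars <;> field_simp
    ring
  rw [jucysMurphy_apply_rho (Equiv.swap_apply_of_ne_of_ne h1 h2) (fun q => ?_), hx p, map_smul,
    Equiv.swap_apply_of_ne_of_ne h1 h2, smul_sub, smul_comm]
  have h1' : (p : ℕ) ≠ k := fun h => h1 (Fin.ext h)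
  have h2' : (p : ℕ) ≠ l := fun h => h2 (Fin.ext h)
  rcases eq_or_ne q k with rfl | h3
  · simp only [Equiv.swap_apply_left, Fin.lt_def]; omega
  rcases eq_or_ne q l with rfl | h4
  · simp only [Equiv.swap_apply_right, Fin.lt_def]; omega
  rw [Equiv.swap_apply_of_ne_of_ne h3 h4]

end JucysMurphy

section Unitary

variable {n : ℕ} {W : Type*} [NormedAddCommGroup W] [InnerProductSpace ℂ W]
  {ρ : Representation ℂ (Equiv.Perm (Fin n)) W}

theorem jucysMurphy_isSymmetric
    (hinv : ∀ (σ : Equiv.Perm (Fin n)) (x y : W), inner ℂ (ρ σ x) (ρ σ y) = inner ℂ x y)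
    (p : Fin n) : (jucysMurphy ρ p).IsSymmetric := by
  intro x y
  rw [jucysMurphy_apply, jucysMurphy_apply, inner_sum, sum_inner]
  exact Finset.sum_congr rfl fun q _ => by rw [inner_right_comm hinv, Equiv.swap_inv]

/-- Two consecutive eigenvalues differ: otherwise the self-adjointness of the `l`-th Jucys–Murphy
element `J`, applied to `x` and `(k l) x`, and `J (k l) x = a_k (k l) x + x` give `⟨x, x⟩ = 0`. -/
theorem IsWeight.ne_of_succ
    (hinv : ∀ (σ : Equiv.Perm (Fin n)) (x y : W), inner ℂ (ρ σ x) (ρ σ y) = inner ℂ x y)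
    {a : Fin n → ℂ} {x : W} (hx : IsWeight ρ a x) (hx0 : x ≠ 0) {k l : Fin n}
    (hkl : (k : ℕ) + 1 = l) : a k ≠ a l := by
  intro ha
  have hsym := jucysMurphy_isSymmetric hinv l
  have h1 := hsym x (ρ (Equiv.swap k l) x)
  have hreal : (starRingEnd ℂ) (a l) = a l := hsym.conj_eigenvalue_eq_self
    (Module.End.hasEigenvalue_of_hasEigenvector
      ⟨Module.End.mem_eigenspace_iff.2 (hx l), hx0⟩)
  rw [jucysMurphy_swap_succ hkl, hx k, hx l, map_smul, inner_add_right, inner_smul_left,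
    inner_smul_right, hreal, ha, left_eq_add, inner_self_eq_zero] at h1
  exact hx0 h1

/-- The Jucys–Murphy elements act by commuting self-adjoint operators, hence are simultaneously
diagonalizable. -/
theorem exists_weight_basis [FiniteDimensional ℂ W]
    (hinv : ∀ (σ : Equiv.Perm (Fin n)) (x y : W), inner ℂ (ρ σ x) (ρ σ y) = inner ℂ x y) :
    ∃ (s : Set W) (v : Module.Basis s ℂ W) (α : s → Fin n → ℂ), ∀ i, IsWeight ρ (α i) (v i) := by
  have h1 := LinearMap.IsSymmetric.iSup_iInf_eq_top_of_commute (T := jucysMurphy ρ)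
    (jucysMurphy_isSymmetric hinv) fun p r _ => jucysMurphy_commute p r
  have h2 : ⊤ ≤ Submodule.span ℂ {x : W | ∃ a, IsWeight ρ a x} := by
    rw [← h1, iSup_le_iff]
    intro a x hx
    refine Submodule.subset_span ⟨a, fun p => ?_⟩
    exact Module.End.mem_eigenspace_iff.1 ((Submodule.mem_iInf _).1 hx p)
  have h3 (i) : ∃ a, IsWeight ρ a (Module.Basis.ofSpan h2 i) :=
    Module.Basis.ofSpan_subset h2 ⟨i, rfl⟩
  choose α hα using h3
  exact ⟨_, Module.Basis.ofSpan h2, α, hα⟩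

end Unitary

/-! ### The equivariant operator assembled from the ordered products -/

/-- The list `m, …, 2, 1` of the first `m` tensor factors, in the decreasing order. -/
def firstFactors (n m : ℕ) : List (Fin n) := ((List.finRange n).take m).reverse

theorem firstFactors_succ {n m : ℕ} (h : m < n) :
    firstFactors n (m + 1) = ⟨m, h⟩ :: firstFactors n m := by
  rw [firstFactors, List.take_succ_eq_append_getElem (by simpa using h), List.reverse_append]
  simp [firstFactors]

theorem nodup_firstFactors (n m : ℕ) : (firstFactors n m).Nodup :=
  List.nodup_reverse.2 ((List.take_sublist _ _).nodup (List.nodup_finRange n))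

theorem exists_firstFactors_eq {n m : ℕ} (hm : m ≤ n) {k l : Fin n} (hkl : (k : ℕ) + 1 = l)
    (hl : (l : ℕ) < m) : ∃ L L', firstFactors n m = L' ++ l :: k :: L := by
  induction m with
  | zero => omega
  | succ m ih =>
    rw [firstFactors_succ hm]
    rcases (Nat.lt_succ_iff.1 hl).lt_or_eq with h | h
    · obtain ⟨L, L', h'⟩ := ih (Nat.le_of_succ_le hm) h
      exact ⟨L, ⟨m, hm⟩ :: L', by rw [h', List.cons_append]⟩
    · subst h
      have h : firstFactors n l = k :: firstFactors n k := by rw [← hkl, firstFactors_succ k.2]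
      exact ⟨firstFactors n k, [], by rw [h, List.nil_append]⟩

/-- The spectral parameters `u + a_p`. -/
def shifted {n : ℕ} {K : Type*} [Field K] [Algebra ℂ K] (u : K) (a : Fin n → ℂ) (p : Fin n) : K :=
  u + algebraMap ℂ K (a p)

namespace ReflectionData

variable {n : ℕ} {K A : Type*} [Field K] [Ring A] [Algebra K A] [Algebra ℂ K]
  (D : ReflectionData (Fin n) K A)

/-- On a right eigenvector of the Jucys–Murphy elements, the product of the factors
`1 + Q_{qp} / (b_q + b_p)` collapses to one factor, since `Q_{qp} Q_{rp} = (q r) Q_{rp}`. -/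
theorem mul_row_eq {u : K} (hu : ∀ c : ℂ, 2 * u + algebraMap ℂ K c ≠ 0) {a : Fin n → ℂ} (p : Fin n)
    {X : A} (hX : ∀ r < p, X * ∑ q with q < r, D.P (Equiv.swap q r) = algebraMap ℂ K (a r) • X)
    {m : ℕ} (hm : m ≤ p) :
    X * D.row (shifted u a) (firstFactors n m) p =
      X * (1 + (2 * u + algebraMap ℂ K (a p))⁻¹ • ∑ q with Fin.val q < m, D.Q q p) := by
  induction m with
  | zero => simp [firstFactors, row]
  | succ m ih =>
    have hmn : m < n := (Nat.lt_of_succ_le hm).trans p.2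
    set r : Fin n := ⟨m, hmn⟩ with hr
    have hrp : r < p := hm
    have hset : (Finset.univ.filter fun q : Fin n => (q : ℕ) < m + 1) =
        insert r (Finset.univ.filter fun q : Fin n => (q : ℕ) < m) := by
      ext q
      simp only [Finset.mem_filter, Finset.mem_univ, true_and, Finset.mem_insert, Fin.ext_iff, hr]
      omega
    have hQQ : X * ((∑ q with Fin.val q < m, D.Q q p) * D.Q r p) =
        algebraMap ℂ K (a r) • (X * D.Q r p) := by
      rw [← smul_mul_assoc, ← hX r hrp, mul_assoc, Finset.sum_mul, Finset.sum_mul]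
      congr 1
      refine Finset.sum_congr rfl fun q hq => ?_
      have hqr : q < r := (Finset.mem_filter.1 hq).2
      exact D.Q_mul_Q q r p hqr.ne hrp.ne (hqr.trans hrp).ne
    have h1 := hu (a p)
    have h2 := hu (a r + a p)
    have h3 : shifted u a r + shifted u a p = 2 * u + algebraMap ℂ K (a r + a p) := by
      rw [shifted, shifted, map_add]; ring
    rw [firstFactors_succ hmn, row, ← hr, ← mul_assoc, ih (Nat.le_of_succ_le hm), R, h3, hset,
      Finset.sum_insert (by simp [hr])]
    generalize (∑ q with Fin.val q < m, D.Q q p) = S at hQQ ⊢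
    simp only [mul_add, add_mul, mul_one, smul_add, smul_mul_assoc, mul_smul_comm, mul_assoc, hQQ]
    rw [map_add] at h2 ⊢
    match_scalars
    all_goals field_simp
    ring

/-- The ordered product in which the factors `1 + Q_{qp} / (b_q + b_p)`, `q < p`, are replaced by
`1 + ∑_q Q_{qp} / (2 u + a_p)`. -/
def sumProd (u : K) (a : Fin n → ℂ) (L : List (Fin n)) : A :=
  (L.map fun p => (1 + (2 * u + algebraMap ℂ K (a p))⁻¹ • ∑ q with q < p, D.Q q p) *
    D.F p (shifted u a p)).prod

end ReflectionData

section Theta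

variable {n : ℕ} {K A W U : Type*} [Field K] [Ring A] [Algebra K A] [Algebra ℂ K] [Algebra ℂ A]
  [AddCommGroup W] [Module ℂ W] [AddCommGroup U] [Module ℂ U]
  {ρ : Representation ℂ (Equiv.Perm (Fin n)) W} (D : ReflectionData (Fin n) K A)

/-- `Ψ` is equivariant for `ρ` and for the right multiplication by the permutation operators. -/
def IsEquivariant (ρ : Representation ℂ (Equiv.Perm (Fin n)) W)
    (D : ReflectionData (Fin n) K A) (Ψ : W →ₗ[ℂ] A) : Prop :=
  ∀ σ x, Ψ (ρ σ x) * D.P σ = Ψ x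

variable {ι : Type*} (v : Module.Basis ι ℂ W) (α : ι → Fin n → ℂ)

/-- The linear map that sends an eigenvector `x` of the Jucys–Murphy elements, with the
eigenvalues `a`, to `Ψ x` multiplied by the ordered product for the first `m` tensor factors with
the spectral parameters `u + a`. It is defined on a basis `v` of eigenvectors. -/
def theta (u : K) (m : ℕ) (Ψ : W →ₗ[ℂ] A) : W →ₗ[ℂ] A :=
  v.constr ℂ fun i => Ψ (v i) * D.prod (shifted u (α i)) (firstFactors n m)

variable {v α}

theorem theta_add (u : K) (m : ℕ) (Ψ Ψ' : W →ₗ[ℂ] A) :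
    theta D v α u m (Ψ + Ψ') = theta D v α u m Ψ + theta D v α u m Ψ' :=
  v.ext fun i => by simp [theta, add_mul]

theorem theta_smul (u : K) (m : ℕ) (c : ℂ) (Ψ : W →ₗ[ℂ] A) :
    theta D v α u m (c • Ψ) = c • theta D v α u m Ψ :=
  v.ext fun i => by simp [theta]

/-- The map `theta` does not depend on the basis: the formula that defines it on the basis holds for
every eigenvector, since an eigenvector involves only basis vectors with the same eigenvalues. -/
theorem theta_apply_of_isWeight (hα : ∀ i, IsWeight ρ (α i) (v i)) (u : K) (m : ℕ)
    (Ψ : W →ₗ[ℂ] A) {a : Fin n → ℂ} {x : W} (hx : IsWeight ρ a x) :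
    theta D v α u m Ψ x = Ψ x * D.prod (shifted u a) (firstFactors n m) := by
  have hrepr (i : ι) (hi : v.repr x i ≠ 0) : α i = a := by
    funext p
    have h1 : v.repr (jucysMurphy ρ p x) i = v.repr x i * α i p := by
      conv_lhs => rw [← v.linearCombination_repr x, Finsupp.linearCombination_apply, Finsupp.sum,
        map_sum]
      simp_rw [map_smul, hα _ p, map_sum, map_smul, v.repr_self, Finsupp.finsetSum_apply,
        Finsupp.smul_apply]
      rw [Finset.sum_eq_single i]
      · simp
      · intro j _ hj
        simp [hj]
      · intro h
        simp [Finsupp.notMem_support_iff.1 h]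
    rw [hx p, map_smul, Finsupp.smul_apply, smul_eq_mul, mul_comm] at h1
    exact (mul_left_cancel₀ hi h1).symm
  rw [theta, Module.Basis.constr_apply]
  conv_rhs => rw [← v.linearCombination_repr x, Finsupp.linearCombination_apply, Finsupp.sum,
    map_sum, Finset.sum_mul]
  refine Finset.sum_congr rfl fun i hi => ?_
  simp only
  rw [hrepr i (Finsupp.mem_support_iff.1 hi), map_smul, smul_mul_assoc]

variable [IsScalarTower ℂ K A]

/-- Equivariance under a transposition of neighbours: the operator which interchanges two
eigenvalues of `x` is matched by the one which interchanges two parameters of the product. -/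
theorem theta_rho_swap_succ (hα : ∀ i, IsWeight ρ (α i) (v i))
    (hne : ∀ {a : Fin n → ℂ} {x : W}, IsWeight ρ a x → x ≠ 0 → ∀ {k l : Fin n},
      (k : ℕ) + 1 = l → a k ≠ a l)
    {u : K} (hu : ∀ c : ℂ, 2 * u + algebraMap ℂ K c ≠ 0) {m : ℕ} (hm : m ≤ n)
    {Ψ : W →ₗ[ℂ] A} (hΨ : IsEquivariant ρ D Ψ) {k l : Fin n} (hkl : (k : ℕ) + 1 = l)
    (hl : (l : ℕ) < m) (x : W) :
    theta D v α u m Ψ (ρ (Equiv.swap k l) x) = theta D v α u m Ψ x * D.P (Equiv.swap k l) := by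
  suffices h : theta D v α u m Ψ ∘ₗ ρ (Equiv.swap k l) =
      LinearMap.mulRight ℂ (D.P (Equiv.swap k l)) ∘ₗ theta D v α u m Ψ from
    LinearMap.congr_fun h x
  refine v.ext fun i => ?_
  simp only [LinearMap.comp_apply, LinearMap.mulRight_apply]
  have hx := hα i
  have hx0 : v i ≠ 0 := v.ne_zero i
  generalize v i = x at hx hx0 ⊢
  generalize α i = a at hx
  set s := Equiv.swap k l with hs
  have ha := hne hx hx0 hkl
  have hb (a : Fin n → ℂ) (q r : Fin n) : shifted u a q + shifted u a r ≠ 0 := by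
    have h := hu (a q + a r)
    rwa [map_add, two_mul, add_add_add_comm] at h
  obtain ⟨L, L', hL⟩ := exists_firstFactors_eq hm hkl hl
  have hab : shifted u (a ∘ s) k ≠ shifted u (a ∘ s) l := by
    simp only [shifted, Function.comp, hs, Equiv.swap_apply_left, Equiv.swap_apply_right, ne_eq,
      add_right_inj]
    exact fun h => ha.symm ((algebraMap ℂ K).injective h)
  have hint := D.intertwiner_mul_prod (shifted u (a ∘ s)) hab (hb _) L L'
    (hL ▸ nodup_firstFactors n m)
  have hback : shifted u (a ∘ s) ∘ s = shifted u a := by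
    funext p
    simp [shifted, hs]
  have hop : D.intertwiner (shifted u (a ∘ s)) k l =
      D.P s - algebraMap ℂ A (a l - a k)⁻¹ := by
    rw [ReflectionData.intertwiner, IsScalarTower.algebraMap_apply ℂ K A,
      sub_eq_add_neg (D.P s), ← map_neg, ← map_neg, ← inv_neg, neg_sub,
      map_inv₀ (algebraMap ℂ K), map_sub (algebraMap ℂ K)]
    simp only [shifted, Function.comp, hs, Equiv.swap_apply_left, Equiv.swap_apply_right,
      add_sub_add_left_eq_sub]
  rw [← hL, ← hs, hback, hop] at hint
  have hy := theta_apply_of_isWeight D hα u m Ψ (hx.swap_sub hkl ha)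
  have hΨs : Ψ (ρ s x) = Ψ x * D.P s := by
    rw [← hΨ s x, mul_assoc, D.P_swap_mul_self, mul_one]
  have hΨy : Ψ (ρ s x - (a l - a k)⁻¹ • x) = Ψ x * (D.P s - algebraMap ℂ A (a l - a k)⁻¹) := by
    rw [map_sub, map_smul, hΨs, mul_sub, ← Algebra.commutes, ← Algebra.smul_def]
  rw [← hs, hΨy, mul_assoc, hint, map_sub, map_smul, ← mul_assoc,
    ← theta_apply_of_isWeight D hα u m Ψ hx, mul_sub, ← Algebra.commutes, ← Algebra.smul_def,
    sub_left_inj] at hy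
  exact hy

/-- The product for the first `m` factors is equivariant under the transpositions in `S_m`, as these
are conjugate to transpositions of neighbours. -/
theorem theta_rho_swap (hα : ∀ i, IsWeight ρ (α i) (v i))
    (hne : ∀ {a : Fin n → ℂ} {x : W}, IsWeight ρ a x → x ≠ 0 → ∀ {k l : Fin n},
      (k : ℕ) + 1 = l → a k ≠ a l)
    {u : K} (hu : ∀ c : ℂ, 2 * u + algebraMap ℂ K c ≠ 0) {m : ℕ} (hm : m ≤ n)
    {Ψ : W →ₗ[ℂ] A} (hΨ : IsEquivariant ρ D Ψ) {q : Fin n} {r : ℕ} (hqr : (q : ℕ) < r)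
    (hr : r < m) (x : W) :
    theta D v α u m Ψ (ρ (Equiv.swap q ⟨r, hr.trans_le hm⟩) x) =
      theta D v α u m Ψ x * D.P (Equiv.swap q ⟨r, hr.trans_le hm⟩) := by
  induction r generalizing x with
  | zero => omega
  | succ r ih =>
    have hrm := (Nat.lt_succ_self r).trans hr
    have hadj := theta_rho_swap_succ D hα hne hu hm hΨ
      (k := ⟨r, hrm.trans_le hm⟩) (l := ⟨r + 1, hr.trans_le hm⟩) rfl hr
    rcases (Nat.lt_succ_iff.1 hqr).lt_or_eq with h | h
    · have e := Equiv.swap_mul_swap_mul_swap (x := (⟨r + 1, hr.trans_le hm⟩ : Fin n))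
        (y := ⟨r, hrm.trans_le hm⟩) (z := q)
        (by simp [Fin.ext_iff]) (by simp [Fin.ext_iff]; omega)
      rw [← e]
      simp only [map_mul, Module.End.mul_apply, ← mul_assoc]
      rw [Equiv.swap_comm (⟨r, _⟩ : Fin n) q, Equiv.swap_comm (⟨r + 1, _⟩ : Fin n), ih h hrm, hadj,
        ih h hrm]
    · have : q = ⟨r, hrm.trans_le hm⟩ := Fin.ext h
      rw [this]
      exact hadj x

/-- The full ordered product gives a map equivariant for the whole symmetric group. -/
theorem isEquivariant_theta (hα : ∀ i, IsWeight ρ (α i) (v i))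
    (hne : ∀ {a : Fin n → ℂ} {x : W}, IsWeight ρ a x → x ≠ 0 → ∀ {k l : Fin n},
      (k : ℕ) + 1 = l → a k ≠ a l)
    {u : K} (hu : ∀ c : ℂ, 2 * u + algebraMap ℂ K c ≠ 0)
    {Ψ : W →ₗ[ℂ] A} (hΨ : IsEquivariant ρ D Ψ) : IsEquivariant ρ D (theta D v α u n Ψ) := by
  intro σ
  induction σ using Equiv.Perm.swap_induction_on with
  | one => simp
  | swap_mul σ q r hqr ih =>
    intro x
    have h (y : W) : theta D v α u n Ψ (ρ (Equiv.swap q r) y) =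
        theta D v α u n Ψ y * D.P (Equiv.swap q r) := by
      rcases hqr.lt_or_gt with h | h
      · exact theta_rho_swap D hα hne hu le_rfl hΨ h r.2 y
      · rw [Equiv.swap_comm]
        exact theta_rho_swap D hα hne hu le_rfl hΨ h q.2 y
    rw [map_mul, map_mul, Module.End.mul_apply, h, mul_assoc, ← mul_assoc (D.P _) (D.P _),
      D.P_swap_mul_self, one_mul, ih]

theorem theta_mul_jucysMurphy (hα : ∀ i, IsWeight ρ (α i) (v i))
    (hne : ∀ {a : Fin n → ℂ} {x : W}, IsWeight ρ a x → x ≠ 0 → ∀ {k l : Fin n},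
      (k : ℕ) + 1 = l → a k ≠ a l)
    {u : K} (hu : ∀ c : ℂ, 2 * u + algebraMap ℂ K c ≠ 0) {m : ℕ} (hm : m ≤ n)
    {Ψ : W →ₗ[ℂ] A} (hΨ : IsEquivariant ρ D Ψ) {a : Fin n → ℂ} {x : W} (hx : IsWeight ρ a x)
    {r : Fin n} (hr : (r : ℕ) < m) :
    theta D v α u m Ψ x * ∑ q with q < r, D.P (Equiv.swap q r) =
      algebraMap ℂ K (a r) • theta D v α u m Ψ x := by
  rw [algebraMap_smul, ← map_smul, ← hx r, jucysMurphy_apply, map_sum, Finset.mul_sum]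
  refine Finset.sum_congr rfl fun q hq => ?_
  exact (theta_rho_swap D hα hne hu hm hΨ (Finset.mem_filter.1 hq).2 hr x).symm

/-- The products over `q` in the ordered product may be replaced by sums, one tensor factor at a
time. -/
theorem theta_apply_eq_mul_sumProd (hα : ∀ i, IsWeight ρ (α i) (v i))
    (hne : ∀ {a : Fin n → ℂ} {x : W}, IsWeight ρ a x → x ≠ 0 → ∀ {k l : Fin n},
      (k : ℕ) + 1 = l → a k ≠ a l)
    {u : K} (hu : ∀ c : ℂ, 2 * u + algebraMap ℂ K c ≠ 0)
    {Ψ : W →ₗ[ℂ] A} (hΨ : IsEquivariant ρ D Ψ) {a : Fin n → ℂ} {x : W} (hx : IsWeight ρ a x)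
    {m : ℕ} (hm : m ≤ n) :
    theta D v α u m Ψ x = Ψ x * D.sumProd u a ((List.finRange n).take m) := by
  induction m with
  | zero =>
    rw [theta_apply_of_isWeight D hα u 0 Ψ hx]
    simp [firstFactors, ReflectionData.prod, ReflectionData.sumProd]
  | succ m ih =>
    have hmn := Nat.lt_of_succ_le hm
    have h1 := theta_apply_of_isWeight D hα u m Ψ hx
    have h2 := D.mul_row_eq hu (a := a) ⟨m, hmn⟩ (m := m) (X := theta D v α u m Ψ x)
      (fun r hr => theta_mul_jucysMurphy D hα hne hu hmn.le hΨ hx hr) le_rfl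
    rw [theta_apply_of_isWeight D hα u (m + 1) Ψ hx, firstFactors_succ hmn, ReflectionData.prod,
      ← mul_assoc, ← mul_assoc, ← h1, h2, ih hmn.le, ReflectionData.sumProd,
      ReflectionData.sumProd, List.take_succ_eq_append_getElem (by simpa using hmn),
      List.map_append, List.prod_append]
    simp only [List.getElem_finRange, Fin.cast_mk, List.map_cons, List.map_nil, List.prod_singleton,
      mul_assoc, Fin.lt_def]

end Theta

/-! ### Independence of the eigenvector -/

section Invariance

variable {n : ℕ} {K A W U : Type*} [Field K] [Ring A] [Algebra K A] [Algebra ℂ A]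
  [NormedAddCommGroup W] [InnerProductSpace ℂ W] [AddCommGroup U] [Module ℂ U]
  {ρ : Representation ℂ (Equiv.Perm (Fin n)) W} (D : ReflectionData (Fin n) K A)

/-- The operator `∑_σ ⟨w, σ x⟩ σ`, as a sesquilinear function of `w` and `x`. -/
def matrixCoefficient (ρ : Representation ℂ (Equiv.Perm (Fin n)) W)
    (D : ReflectionData (Fin n) K A) : W →ₗ⋆[ℂ] W →ₗ[ℂ] A :=
  LinearMap.mk₂'ₛₗ (starRingEnd ℂ) (RingHom.id ℂ)
    (fun w x => ∑ σ : Equiv.Perm (Fin n), (inner ℂ w (ρ σ x) : ℂ) • D.P σ)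
    (fun w w' x => by simp only [inner_add_left, add_smul, Finset.sum_add_distrib])
    (fun c w x => by simp only [inner_smul_left, mul_smul, Finset.smul_sum])
    (fun w x x' => by simp only [map_add, inner_add_right, add_smul, Finset.sum_add_distrib])
    (fun c w x => by simp only [map_smul, inner_smul_right, mul_smul, Finset.smul_sum,
      RingHom.id_apply])

theorem matrixCoefficient_apply (w x : W) : matrixCoefficient ρ D w x =
    ∑ σ : Equiv.Perm (Fin n), (inner ℂ w (ρ σ x) : ℂ) • D.P σ := rfl

theorem isEquivariant_matrixCoefficient (w : W) :
    IsEquivariant ρ D (matrixCoefficient ρ D w) := by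
  intro τ x
  rw [matrixCoefficient_apply, matrixCoefficient_apply, Finset.sum_mul]
  refine Fintype.sum_equiv (Equiv.mulRight τ) _ _ fun σ => ?_
  rw [Equiv.coe_mulRight, map_mul, map_mul, Module.End.mul_apply, smul_mul_assoc]

theorem matrixCoefficient_rho
    (hinv : ∀ (σ : Equiv.Perm (Fin n)) (x y : W), inner ℂ (ρ σ x) (ρ σ y) = inner ℂ x y)
    (τ : Equiv.Perm (Fin n)) (w x : W) :
    matrixCoefficient ρ D (ρ τ w) x = D.P τ * matrixCoefficient ρ D w x := by
  rw [matrixCoefficient_apply, matrixCoefficient_apply, Finset.mul_sum]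
  refine (Fintype.sum_equiv (Equiv.mulLeft τ) _ _ fun σ => ?_).symm
  rw [Equiv.coe_mulLeft, map_mul, map_mul, Module.End.mul_apply, hinv, mul_smul_comm]

/-- For a functional `tr` which is cyclic with respect to the permutation operators, the value of
`tr` on the diagonal matrix coefficient of a Jucys–Murphy eigenvector times the corresponding
ordered product does not depend on the eigenvector. -/
theorem trace_matrixCoefficient_eq [Algebra ℂ K] [IsScalarTower ℂ K A] (hirr : ρ.IsIrreducible)
    (hinv : ∀ (σ : Equiv.Perm (Fin n)) (x y : W), inner ℂ (ρ σ x) (ρ σ y) = inner ℂ x y)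
    {u : K} (hu : ∀ c : ℂ, 2 * u + algebraMap ℂ K c ≠ 0) (tr : A →ₗ[ℂ] U)
    (htr : ∀ σ x, tr (D.P σ * x) = tr (x * D.P σ)) {a a' : Fin n → ℂ} {w w' : W}
    (hw : IsWeight ρ a w) (hw' : IsWeight ρ a' w') (hw1 : inner ℂ w w = (1 : ℂ))
    (hw1' : inner ℂ w' w' = (1 : ℂ)) :
    tr (matrixCoefficient ρ D w w * D.sumProd u a (List.finRange n)) =
      tr (matrixCoefficient ρ D w' w' * D.sumProd u a' (List.finRange n)) := by
  have := finiteDimensional_of_isIrreducible hirr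
  obtain ⟨s, v, α, hα⟩ := exists_weight_basis hinv
  have hne {a : Fin n → ℂ} {x : W} (hx : IsWeight ρ a x) (hx0 : x ≠ 0) {k l : Fin n}
      (hkl : (k : ℕ) + 1 = l) : a k ≠ a l := hx.ne_of_succ hinv hx0 hkl
  let B : W →ₗ⋆[ℂ] W →ₗ[ℂ] U := LinearMap.mk₂'ₛₗ (starRingEnd ℂ) (RingHom.id ℂ)
    (fun w x => tr (theta D v α u n (matrixCoefficient ρ D w) x))
    (fun w w' x => by rw [map_add, theta_add, LinearMap.add_apply, map_add])
    (fun c w x => by rw [map_smulₛₗ, theta_smul, LinearMap.smul_apply, map_smul])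
    (fun w x x' => by simp only [map_add])
    (fun c w x => by simp only [map_smul, RingHom.id_apply])
  have hB (w x : W) : B w x = tr (theta D v α u n (matrixCoefficient ρ D w) x) := rfl
  have hBinv (σ : Equiv.Perm (Fin n)) (x y : W) : B (ρ σ x) (ρ σ y) = B x y := by
    have h1 : theta D v α u n (matrixCoefficient ρ D (ρ σ x)) =
        LinearMap.mulLeft ℂ (D.P σ) ∘ₗ theta D v α u n (matrixCoefficient ρ D x) := by
      refine v.ext fun i => ?_
      simp only [theta, LinearMap.comp_apply, Module.Basis.constr_basis, LinearMap.mulLeft_apply,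
        matrixCoefficient_rho D hinv, mul_assoc]
    rw [hB, h1, LinearMap.comp_apply, LinearMap.mulLeft_apply, htr,
      isEquivariant_theta D hα hne hu (isEquivariant_matrixCoefficient D x) σ y, hB]
  have key {a : Fin n → ℂ} {w : W} (hw : IsWeight ρ a w) :
      tr (matrixCoefficient ρ D w w * D.sumProd u a (List.finRange n)) = B w w := by
    rw [hB, theta_apply_eq_mul_sumProd D hα hne hu (isEquivariant_matrixCoefficient D w) hw le_rfl,
      List.take_of_length_le (by simp)]
  rw [key hw, key hw']
  exact invariant_sesquilinear_eq hirr hinv B hBinv hw1 hw1'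

/-- A version of `trace_matrixCoefficient_eq` in which all scalars are elements of the algebra. -/
theorem trace_sum_mul_sumProd_eq [Algebra ℂ K] [IsScalarTower ℂ K A] (hirr : ρ.IsIrreducible)
    (hinv : ∀ (σ : Equiv.Perm (Fin n)) (x y : W), inner ℂ (ρ σ x) (ρ σ y) = inner ℂ x y)
    {u : K} (hu : ∀ c : ℂ, 2 * u + algebraMap ℂ K c ≠ 0) (tr : A →+ U)
    (hsmul : ∀ (c : ℂ) x, tr (algebraMap ℂ A c * x) = c • tr x)
    (htr : ∀ σ x, tr (D.P σ * x) = tr (x * D.P σ)) {a a' : Fin n → ℂ} {w w' : W}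
    (hw : IsWeight ρ a w) (hw' : IsWeight ρ a' w') (hw1 : inner ℂ w w = (1 : ℂ))
    (hw1' : inner ℂ w' w' = (1 : ℂ)) (c : ℂ) :
    tr ((∑ σ, algebraMap ℂ A (c * inner ℂ w (ρ σ w)) * D.P σ) *
        D.sumProd u a (List.finRange n)) =
      tr ((∑ σ, algebraMap ℂ A (c * inner ℂ w' (ρ σ w')) * D.P σ) *
        D.sumProd u a' (List.finRange n)) := by
  have h (w : W) : ∑ σ, algebraMap ℂ A (c * inner ℂ w (ρ σ w)) * D.P σ =
      algebraMap ℂ A c * matrixCoefficient ρ D w w := by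
    rw [matrixCoefficient_apply, Finset.mul_sum]
    exact Finset.sum_congr rfl fun σ _ => by
      rw [map_mul, mul_assoc, Algebra.smul_def (inner ℂ w (ρ σ w)) (D.P σ)]
  rw [h, h, mul_assoc, mul_assoc, hsmul, hsmul]
  congr 1
  let trₗ : A →ₗ[ℂ] U :=
    { toFun := tr
      map_add' := map_add tr
      map_smul' := fun c x => by rw [Algebra.smul_def, hsmul, RingHom.id_apply] }
  exact trace_matrixCoefficient_eq D hirr hinv hu trₗ htr hw hw' hw1 hw1'

end Invariance

/-! ### The transposition for the form and the Casimir identities -/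

section Transposition

variable {G : ClassicalGroup}

/-- The signs `s_i` with `ε_{ij} = s_i s_j`: they are `1` for `O_N`, and `sgn i` for `Sp_N`. -/
def formSign : (G : ClassicalGroup) → Idx G → ℂ
  | .O _, _ => 1
  | .Sp _, i => ((i.1.sign : ℤ) : ℂ)

theorem eps_eq (i j : Idx G) : eps G i j = formSign G i * formSign G j := by
  cases G <;> simp [eps, formSign]

theorem formSign_mul_self (i : Idx G) : formSign G i * formSign G i = 1 := by
  cases G with
  | O N => simp [formSign]
  | Sp M => simpa [formSign] using congrArg (Int.cast : ℤ → ℂ) (Idx.sign_mul_self i)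

theorem formSign_neg (i : Idx G) : formSign G i.neg = 2 * eta G * formSign G i := by
  cases G with
  | O N => simp [formSign, eta]
  | Sp M => simp [formSign, eta, Idx.neg, Int.sign_neg]

theorem two_mul_eta_sq (G : ClassicalGroup) : (2 * eta G) ^ 2 = 1 := by
  cases G <;> simp [eta]

theorem eps_neg_neg (i j : Idx G) : eps G i.neg j.neg = eps G i j := by
  rw [eps_eq, eps_eq, formSign_neg, formSign_neg]
  linear_combination (formSign G i * formSign G j) * two_mul_eta_sq G

theorem eps_comm (i j : Idx G) : eps G i j = eps G j i := by
  rw [eps_eq, eps_eq, mul_comm]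

theorem eps_mul_eps (i j k : Idx G) : eps G i j * eps G j k = eps G i k := by
  rw [eps_eq, eps_eq, eps_eq]
  linear_combination (formSign G i * formSign G k) * formSign_mul_self j

theorem eps_mul_self (i j : Idx G) : eps G i j * eps G i j = 1 := by
  rw [eps_eq]
  linear_combination (formSign G i * formSign G i) * formSign_mul_self j + formSign_mul_self i

theorem eps_self_neg (i : Idx G) : eps G i i.neg = 2 * eta G := by
  rw [eps_eq, formSign_neg]
  linear_combination (2 * eta G) * formSign_mul_self i

/-- The permutation `i ↦ -i` of the indices. -/
def negEquiv (G : ClassicalGroup) : Idx G ≃ Idx G := ⟨Idx.neg, Idx.neg, Idx.neg_neg, Idx.neg_neg⟩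

theorem neg_eq_iff {a b : Idx G} : a.neg = b ↔ a = b.neg :=
  ⟨fun h => by rw [← h, Idx.neg_neg], fun h => by rw [h, Idx.neg_neg]⟩

/-- The transposition with respect to the bilinear form: it is determined by
`E_{ij} ↦ ε_{ij} E_{-j,-i}`. -/
def adj (G : ClassicalGroup) : EndN G →ₗ[ℂ] EndN G where
  toFun A := Matrix.of fun a b => eps G a b * A b.neg a.neg
  map_add' A B := by ext a b; simp [mul_add]
  map_smul' c A := by ext a b; simp [mul_left_comm]

theorem adj_apply (A : EndN G) (a b : Idx G) : adj G A a b = eps G a b * A b.neg a.neg := rfl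

theorem adj_E (i j : Idx G) : adj G (E i j) = eps G i j • E j.neg i.neg := by
  ext a b
  rw [adj_apply, Matrix.smul_apply, E, E, Matrix.single_apply, Matrix.single_apply]
  by_cases h : i = b.neg ∧ j = a.neg
  · obtain ⟨rfl, rfl⟩ := h
    simp [Idx.neg_neg, eps_neg_neg, eps_comm]
  · have h' : ¬(j.neg = a ∧ i.neg = b) := fun h' =>
      h ⟨neg_eq_iff.1 h'.2, neg_eq_iff.1 h'.1⟩
    simp [h, h']

theorem adj_adj (A : EndN G) : adj G (adj G A) = A := by
  ext a b
  rw [adj_apply, adj_apply, eps_neg_neg, Idx.neg_neg, Idx.neg_neg, ← mul_assoc, eps_comm b a,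
    eps_mul_self, one_mul]

theorem adj_mul (A B : EndN G) : adj G (A * B) = adj G B * adj G A := by
  ext a b
  rw [adj_apply, Matrix.mul_apply, Matrix.mul_apply, Finset.mul_sum]
  refine Fintype.sum_equiv (negEquiv G) _ _ fun c => ?_
  simp only [negEquiv, Equiv.coe_fn_mk, adj_apply, Idx.neg_neg]
  rw [← eps_mul_eps a c.neg b]
  ring

variable {M : Type*} [AddCommGroup M] [Module ℂ M]

theorem eq_sum_E (A : EndN G) : A = ∑ i, ∑ j, A i j • E i j := by
  conv_lhs => rw [Matrix.matrix_eq_sum_single A]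
  simp [E, Matrix.smul_single]

/-- The Casimir tensor `∑ E_{ij} ⊗ E_{ji}` transports an operator on one factor to the operator on
the other one which is adjoint for the trace form. -/
theorem sum_casimir (β : EndN G →ₗ[ℂ] EndN G →ₗ[ℂ] M) (L L' : EndN G → EndN G)
    (h : ∀ i j k l, L (E i j) k l = L' (E l k) j i) :
    ∑ i, ∑ j, β (L (E i j)) (E j i) = ∑ i, ∑ j, β (E i j) (L' (E j i)) := by
  have h1 (i j : Idx G) : β (L (E i j)) (E j i) =
      ∑ k, ∑ l, L' (E l k) j i • β (E k l) (E j i) := by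
    conv_lhs => rw [eq_sum_E (L (E i j))]
    simp only [map_sum, map_smul, LinearMap.sum_apply, LinearMap.smul_apply, h]
  have h2 (k l : Idx G) : β (E k l) (L' (E l k)) =
      ∑ j, ∑ i, L' (E l k) j i • β (E k l) (E j i) := by
    conv_lhs => rw [eq_sum_E (L' (E l k))]
    simp only [map_sum, map_smul]
  simp only [h1, h2]
  calc _ = ∑ i, ∑ k, ∑ j, ∑ l, L' (E l k) j i • β (E k l) (E j i) :=
        Finset.sum_congr rfl fun i _ => Finset.sum_comm
    _ = ∑ k, ∑ i, ∑ j, ∑ l, L' (E l k) j i • β (E k l) (E j i) := Finset.sum_comm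
    _ = ∑ k, ∑ i, ∑ l, ∑ j, L' (E l k) j i • β (E k l) (E j i) :=
        Finset.sum_congr rfl fun k _ => Finset.sum_congr rfl fun i _ => Finset.sum_comm
    _ = ∑ k, ∑ l, ∑ i, ∑ j, L' (E l k) j i • β (E k l) (E j i) :=
        Finset.sum_congr rfl fun k _ => Finset.sum_comm
    _ = _ := Finset.sum_congr rfl fun k _ => Finset.sum_congr rfl fun l _ => Finset.sum_comm

theorem E_mul_E (i j k l : Idx G) : (E i j * E k l : EndN G) = if j = k then E i l else 0 := by
  rw [E, E]
  split_ifs with h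
  · subst h
    simp [E]
  · simp [h]

theorem sum_E_self : ∑ i, E i i = (1 : EndN G) := by
  ext a b
  simp [E, Matrix.sum_apply, Matrix.single_apply, Matrix.one_apply, ite_and]

theorem sum_casimir_mul_left (β : EndN G →ₗ[ℂ] EndN G →ₗ[ℂ] M) (A : EndN G) :
    ∑ i, ∑ j, β (A * E i j) (E j i) = ∑ i, ∑ j, β (E i j) (E j i * A) :=
  sum_casimir β (A * ·) (· * A) fun i j k l => by
    simp [E, Matrix.mul_apply, Matrix.single_apply, ite_and, eq_comm]

theorem sum_casimir_mul_right (β : EndN G →ₗ[ℂ] EndN G →ₗ[ℂ] M) (A : EndN G) :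
    ∑ i, ∑ j, β (E i j * A) (E j i) = ∑ i, ∑ j, β (E i j) (A * E j i) :=
  sum_casimir β (· * A) (A * ·) fun i j k l => by
    simp [E, Matrix.mul_apply, Matrix.single_apply, ite_and, eq_comm]

theorem sum_casimir_adj (β : EndN G →ₗ[ℂ] EndN G →ₗ[ℂ] M) :
    ∑ i, ∑ j, β (adj G (E i j)) (E j i) = ∑ i, ∑ j, β (E i j) (adj G (E j i)) :=
  sum_casimir β (adj G) (adj G) fun i j k l => by
    rw [adj_apply, adj_apply, E, E, Matrix.single_apply, Matrix.single_apply]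
    by_cases h : i = l.neg ∧ j = k.neg
    · obtain ⟨rfl, rfl⟩ := h
      simp [Idx.neg_neg, eps_neg_neg]
    · have h' : ¬(l = i.neg ∧ k = j.neg) := fun h' =>
        h ⟨by rw [h'.1, Idx.neg_neg], by rw [h'.2, Idx.neg_neg]⟩
      simp [h, h']

end Transposition

/-! ### The operators on the tensor power -/

section TensorPower

variable {G : ClassicalGroup} {n : ℕ}

theorem iota_apply (p : Fin n) (A : EndN G) :
    iota G p A = PiTensorProduct.tprod ℂ (Pi.mulSingle p A) := rfl

theorem iota_commute {p q : Fin n} (h : p ≠ q) (A B : EndN G) :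
    Commute (iota G p A) (iota G q B) := by
  rw [iota_apply, iota_apply, Commute, SemiconjBy, PiTensorProduct.tprod_mul_tprod,
    PiTensorProduct.tprod_mul_tprod]
  congr 1
  exact (Pi.mulSingle_commute (f := fun _ : Fin n => EndN G) h A B).eq

/-- The matrix units `⊗_p E_{g(p) f(p)}`. -/
def tensorUnit (g f : Fin n → Idx G) : EndTensor G n :=
  PiTensorProduct.tprod ℂ fun p => E (g p) (f p)

theorem permOp_eq (σ : Equiv.Perm (Fin n)) :
    permOp G σ = ∑ f : Fin n → Idx G, tensorUnit (f ∘ ⇑σ⁻¹) f := rfl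

theorem tensorUnit_mul_tprod (g f : Fin n → Idx G) (A : Fin n → EndN G) :
    tensorUnit g f * PiTensorProduct.tprod ℂ A =
      ∑ h : Fin n → Idx G, (∏ p, A p (f p) (h p)) • tensorUnit g h := by
  have h1 (p : Fin n) : E (g p) (f p) * A p = ∑ j, A p (f p) j • E (g p) j := by
    conv_lhs => rw [eq_sum_E (A p)]
    simp only [Finset.mul_sum, mul_smul_comm, E_mul_E, smul_ite, smul_zero]
    rw [Finset.sum_comm]
    simp
  rw [tensorUnit, PiTensorProduct.tprod_mul_tprod,
    show (fun p => E (g p) (f p)) * A = fun p => ∑ j, A p (f p) j • E (g p) j from funext h1,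
    MultilinearMap.map_sum]
  exact Finset.sum_congr rfl fun h _ => MultilinearMap.map_smul_univ _ _ _

theorem tprod_mul_tensorUnit (g f : Fin n → Idx G) (A : Fin n → EndN G) :
    PiTensorProduct.tprod ℂ A * tensorUnit g f =
      ∑ h : Fin n → Idx G, (∏ p, A p (h p) (g p)) • tensorUnit h f := by
  have h1 (p : Fin n) : A p * E (g p) (f p) = ∑ j, A p j (g p) • E j (f p) := by
    conv_lhs => rw [eq_sum_E (A p)]
    simp only [Finset.sum_mul, smul_mul_assoc, E_mul_E, smul_ite, smul_zero]
    simp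
  rw [tensorUnit, PiTensorProduct.tprod_mul_tprod,
    show A * (fun p => E (g p) (f p)) = fun p => ∑ j, A p j (g p) • E j (f p) from funext h1,
    MultilinearMap.map_sum]
  exact Finset.sum_congr rfl fun h _ => MultilinearMap.map_smul_univ _ _ _

theorem permOp_mul_tprod (σ : Equiv.Perm (Fin n)) (A : Fin n → EndN G) :
    permOp G σ * PiTensorProduct.tprod ℂ A =
      PiTensorProduct.tprod ℂ (A ∘ ⇑σ⁻¹) * permOp G σ := by
  simp only [permOp_eq, Finset.sum_mul, Finset.mul_sum, tensorUnit_mul_tprod, tprod_mul_tensorUnit]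
  rw [Finset.sum_comm]
  refine Finset.sum_congr rfl fun h _ => ?_
  refine Fintype.sum_equiv (Equiv.arrowCongr σ (Equiv.refl _)) _ _ fun f => ?_
  congr 1
  exact Fintype.prod_equiv σ _ _ fun p => by simp

theorem tensorUnit_mul_tensorUnit (g f g' f' : Fin n → Idx G) :
    tensorUnit g f * tensorUnit g' f' = if f = g' then tensorUnit g f' else 0 := by
  rw [tensorUnit, tensorUnit, PiTensorProduct.tprod_mul_tprod]
  split_ifs with h
  · subst h
    congr 1
    funext p
    simp [E_mul_E]
  · obtain ⟨p, hp⟩ := Function.ne_iff.1 h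
    exact MultilinearMap.map_coord_zero _ p (by simp [E_mul_E, hp])

theorem permOp_one : permOp G (1 : Equiv.Perm (Fin n)) = 1 := by
  have h : (1 : Fin n → EndN G) = fun _ => ∑ i, E i i :=
    funext fun _ => sum_E_self.symm
  rw [PiTensorProduct.one_def, h, MultilinearMap.map_sum]
  rfl

theorem permOp_mul (σ τ : Equiv.Perm (Fin n)) :
    permOp G (σ * τ) = permOp G σ * permOp G τ := by
  simp only [permOp_eq, Finset.sum_mul, Finset.mul_sum, tensorUnit_mul_tensorUnit]
  refine Finset.sum_congr rfl fun f _ => ?_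
  simp
  rfl

/-- The action of the symmetric group on the tensor power, as a homomorphism. -/
def permHom (G : ClassicalGroup) (n : ℕ) : Equiv.Perm (Fin n) →* EndTensor G n where
  toFun := permOp G
  map_one' := permOp_one
  map_mul' := permOp_mul

theorem permOp_mul_iota (σ : Equiv.Perm (Fin n)) (p : Fin n) (A : EndN G) :
    permOp G σ * iota G p A = iota G (σ p) A * permOp G σ := by
  rw [iota_apply, iota_apply, permOp_mul_tprod]
  congr 2
  funext x
  simp only [Function.comp, Pi.mulSingle_apply, Equiv.Perm.inv_eq_iff_eq]

theorem iota_mul_tensorUnit (p : Fin n) (i j : Idx G) (g f : Fin n → Idx G) :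
    iota G p (E i j) * tensorUnit g f =
      if g p = j then tensorUnit (Function.update g p i) f else 0 := by
  rw [iota_apply, tensorUnit, tensorUnit, PiTensorProduct.tprod_mul_tprod]
  split_ifs with h
  · congr 1
    funext x
    rcases eq_or_ne x p with rfl | hx
    · simp [E_mul_E, h]
    · simp [hx]
  · exact MultilinearMap.map_coord_zero _ p (by simp [E_mul_E, Ne.symm h])

theorem permOp_swap {q p : Fin n} (h : q ≠ p) :
    permOp G (Equiv.swap q p) = ∑ i, ∑ j, iota G q (E i j) * iota G p (E j i) := by
  have h1 (f : Fin n → Idx G) : Function.update (Function.update f p (f q)) q (f p) =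
      f ∘ ⇑(Equiv.swap q p)⁻¹ := by
    funext x
    rw [Equiv.swap_inv, Function.comp]
    rcases eq_or_ne x q with rfl | hq
    · simp
    rcases eq_or_ne x p with rfl | hp
    · simp [hq]
    simp [hq, hp, Equiv.swap_apply_of_ne_of_ne hq hp]
  rw [← mul_one (∑ i, ∑ j, iota G q (E i j) * iota G p (E j i)), ← permOp_one, permOp_eq,
    permOp_eq, Finset.mul_sum]
  refine Finset.sum_congr rfl fun f _ => ?_
  simp only [Finset.sum_mul, mul_assoc, iota_mul_tensorUnit, mul_ite, mul_zero, inv_one,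
    Equiv.Perm.coe_one, Function.comp_id, Function.update_of_ne h]
  rw [Finset.sum_eq_single (f p), Finset.sum_eq_single (f q)]
  · simp [h1]
  · intro j _ hj
    simp [hj.symm]
  · simp
  · intro i _ hi
    simp [hi.symm]
  · simp

theorem trTensor_tprod (A : Fin n → EndN G) :
    trTensor G n (PiTensorProduct.tprod ℂ A) = ∏ p, (A p).trace := by
  rw [trTensor, PiTensorProduct.lift.tprod]
  simp

theorem trTensor_mul_comm (x y : EndTensor G n) : trTensor G n (x * y) = trTensor G n (y * x) := by
  induction x using PiTensorProduct.induction_on with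
  | add x x' hx hx' => rw [add_mul, mul_add, map_add, map_add, hx, hx']
  | smul_tprod c A =>
    induction y using PiTensorProduct.induction_on with
    | add y y' hy hy' => rw [add_mul, mul_add, map_add, map_add, hy, hy']
    | smul_tprod d B =>
      have h : ∏ p, ((A * B) p).trace = ∏ p, ((B * A) p).trace :=
        Finset.prod_congr rfl fun p _ => Matrix.trace_mul_comm _ _
      have hAB : (c • PiTensorProduct.tprod ℂ A : EndTensor G n) * (d • PiTensorProduct.tprod ℂ B) =
          (c * d) • PiTensorProduct.tprod ℂ (A * B) :=
        PiTensorProduct.smul_tprod_mul_smul_tprod c d A B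
      have hBA : (d • PiTensorProduct.tprod ℂ B : EndTensor G n) * (c • PiTensorProduct.tprod ℂ A) =
          (d * c) • PiTensorProduct.tprod ℂ (B * A) :=
        PiTensorProduct.smul_tprod_mul_smul_tprod d c B A
      rw [hAB, hBA, map_smul, map_smul, trTensor_tprod, trTensor_tprod, h, mul_comm c]

end TensorPower

/-! ### Verification of the relations -/

/-- The images of `End(ℂ^N)` in the tensor factors, the images `f (E_{ij}) = F_{ij}` of the
generators of the Lie algebra, and the permutation operators, in a common algebra. The laws are
stated without a basis, in terms of the transposition `adj` for the form. -/
structure TensorData (G : ClassicalGroup) (n : ℕ) (A : Type*) [Ring A] [Algebra ℂ A] where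
  ι : Fin n → EndN G →ₐ[ℂ] A
  f : EndN G →ₗ[ℂ] A
  P : Equiv.Perm (Fin n) →* A
  ι_commute : ∀ {p q}, p ≠ q → ∀ X Y, Commute (ι p X) (ι q Y)
  f_commute : ∀ X p Y, Commute (f X) (ι p Y)
  f_adj : ∀ X, f (adj G X) = -f X
  f_bracket : ∀ X Y, f X * f Y - f Y * f X = f ((X - adj G X) * Y - Y * (X - adj G X))
  P_mul_ι : ∀ σ p X, P σ * ι p X = ι (σ p) X * P σ
  P_mul_f : ∀ σ X, P σ * f X = f X * P σ
  P_swap : ∀ {q p}, q ≠ p → P (Equiv.swap q p) = ∑ i, ∑ j, ι q (E i j) * ι p (E j i)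

namespace TensorData

variable {G : ClassicalGroup} {n : ℕ} {A : Type*} [Ring A] [Algebra ℂ A] (D : TensorData G n A)

/-- `Q_{qp} = ∑ ε_{ij} ι_q(E_{ij}) ι_p(E_{-i,-j})`. -/
def Q (q p : Fin n) : A := ∑ i, ∑ j, D.ι q (E i j) * D.ι p (adj G (E j i))

/-- `G_p = ∑ ι_p(E_{ij}) F_{ji}`. -/
def G' (p : Fin n) : A := ∑ i, ∑ j, D.ι p (E i j) * D.f (E j i)

theorem Q_eq (q p : Fin n) :
    D.Q q p = ∑ i, ∑ j, eps G i j • (D.ι q (E i j) * D.ι p (E i.neg j.neg)) := by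
  simp only [Q, adj_E, map_smul, mul_smul_comm, eps_comm]

/-- The bilinear map `(X, Y) ↦ ι_q(X) g(Y)`. -/
def pairing (q : Fin n) (g : EndN G →ₗ[ℂ] A) : EndN G →ₗ[ℂ] EndN G →ₗ[ℂ] A :=
  (LinearMap.mul ℂ A).compl₁₂ (D.ι q).toLinearMap g

theorem pairing_apply (q : Fin n) (g : EndN G →ₗ[ℂ] A) (X Y : EndN G) :
    D.pairing q g X Y = D.ι q X * g Y := rfl

/-- A matrix moves from one tensor factor to the other next to `Q`, as its transpose. -/
theorem Q_mul_ι {q p : Fin n} (h : q ≠ p) (X : EndN G) :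
    D.Q q p * D.ι q X = D.Q q p * D.ι p (adj G X) := by
  have := sum_casimir_mul_right (D.pairing q ((D.ι p).toLinearMap ∘ₗ adj G)) X
  simp only [pairing_apply, LinearMap.comp_apply, AlgHom.toLinearMap_apply, map_mul,
    adj_mul] at this
  simp only [Q, Finset.sum_mul, mul_assoc]
  simp only [mul_assoc] at this
  rw [← this]
  simp only [(D.ι_commute h X _).eq]

theorem ι_mul_Q {q p : Fin n} (h : q ≠ p) (X : EndN G) :
    D.ι q X * D.Q q p = D.ι p (adj G X) * D.Q q p := by
  have := sum_casimir_mul_left (D.pairing q ((D.ι p).toLinearMap ∘ₗ adj G)) X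
  simp only [pairing_apply, LinearMap.comp_apply, AlgHom.toLinearMap_apply, map_mul,
    adj_mul] at this
  simp only [Q, Finset.mul_sum, ← mul_assoc]
  simp only [← mul_assoc] at this
  rw [this]
  simp only [(D.ι_commute h _ (adj G X)).eq]

theorem Q_symm {q p : Fin n} (h : q ≠ p) : D.Q q p = D.Q p q := by
  have := sum_casimir_adj (D.pairing q (D.ι p).toLinearMap)
  simp only [pairing_apply, AlgHom.toLinearMap_apply] at this
  rw [Q, ← this, Q, Finset.sum_comm]
  simp only [(D.ι_commute h _ _).eq]

theorem P_mul_Q (σ : Equiv.Perm (Fin n)) (q p : Fin n) :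
    D.P σ * D.Q q p = D.Q (σ q) (σ p) * D.P σ := by
  simp only [Q, Finset.mul_sum, Finset.sum_mul]
  refine Finset.sum_congr rfl fun i _ => Finset.sum_congr rfl fun j _ => ?_
  rw [← mul_assoc, D.P_mul_ι, mul_assoc, D.P_mul_ι, mul_assoc]

theorem P_mul_G (σ : Equiv.Perm (Fin n)) (p : Fin n) :
    D.P σ * D.G' p = D.G' (σ p) * D.P σ := by
  simp only [G', Finset.mul_sum, Finset.sum_mul]
  refine Finset.sum_congr rfl fun i _ => Finset.sum_congr rfl fun j _ => ?_
  rw [← mul_assoc, D.P_mul_ι, mul_assoc, D.P_mul_f, mul_assoc]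

theorem Q_mul_P {q p : Fin n} (h : q ≠ p) :
    D.Q q p * D.P (Equiv.swap q p) = (2 * eta G) • D.Q q p := by
  have h1 : ∑ i : Idx G, ∑ j, adj G (E i j) * E j i = (2 * eta G) • (1 : EndN G) := by
    simp only [adj_E, smul_mul_assoc, E_mul_E, smul_ite, smul_zero, Finset.sum_ite_eq,
      Finset.mem_univ, if_true, Idx.neg_neg, eps_self_neg, ← Finset.smul_sum, sum_E_self]
  have h2 : D.Q q p * D.P (Equiv.swap q p) =
      D.Q q p * D.ι p (∑ i : Idx G, ∑ j, adj G (E i j) * E j i) := by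
    simp only [D.P_swap h, Finset.mul_sum, map_sum, map_mul, ← mul_assoc, D.Q_mul_ι h]
  rw [h2, h1, map_smul, map_one, mul_smul_comm, mul_one]

theorem P_mul_Q_self {q p : Fin n} (h : q ≠ p) :
    D.P (Equiv.swap q p) * D.Q q p = (2 * eta G) • D.Q q p := by
  rw [D.P_mul_Q, Equiv.swap_apply_left, Equiv.swap_apply_right, ← D.Q_symm h, D.Q_mul_P h]

theorem commute_ι_Q {r q p : Fin n} (hq : r ≠ q) (hp : r ≠ p) (X : EndN G) :
    Commute (D.ι r X) (D.Q q p) :=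
  .sum_right _ _ _ fun _ _ => .sum_right _ _ _ fun _ _ =>
    (D.ι_commute hq _ _).mul_right (D.ι_commute hp _ _)

theorem Q_mul_Q {q r p : Fin n} (hqr : q ≠ r) (hrp : r ≠ p) (hqp : q ≠ p) :
    D.Q q p * D.Q r p = D.P (Equiv.swap q r) * D.Q r p := by
  have h1 (k l : Idx G) : D.Q q p * (D.ι r (E k l) * D.ι p (adj G (E l k))) =
      D.Q q p * (D.ι q (E l k) * D.ι r (E k l)) := by
    rw [(D.ι_commute hrp _ _).eq, ← mul_assoc, ← D.Q_mul_ι hqp, mul_assoc]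
  have h2 : D.Q q p * D.Q r p = D.Q q p * D.P (Equiv.swap q r) := by
    have h3 : D.Q r p = ∑ k, ∑ l, D.ι r (E k l) * D.ι p (adj G (E l k)) := rfl
    rw [D.P_swap hqr, h3, Finset.sum_comm]
    simp only [Finset.mul_sum, h1]
  rw [h2, D.P_mul_Q, Equiv.swap_apply_right, Equiv.swap_apply_of_ne_of_ne hqp.symm hrp.symm]

theorem commute_f_Q (X : EndN G) (q p : Fin n) : Commute (D.f X) (D.Q q p) :=
  .sum_right _ _ _ fun _ _ => .sum_right _ _ _ fun _ _ =>
    (D.f_commute _ _ _).mul_right (D.f_commute _ _ _)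

theorem Q_mul_G {q p : Fin n} (h : q ≠ p) : D.Q q p * D.G' q = -(D.Q q p * D.G' p) := by
  have := sum_casimir_adj (D.pairing p D.f)
  simp only [pairing_apply, D.f_adj, mul_neg, Finset.sum_neg_distrib] at this
  rw [G', G', ← mul_neg, ← this]
  simp only [Finset.mul_sum, ← mul_assoc, D.Q_mul_ι h]

theorem G_mul_Q {q p : Fin n} (h : q ≠ p) : D.G' q * D.Q q p = -(D.G' p * D.Q q p) := by
  have := sum_casimir_adj (D.pairing p D.f)
  simp only [pairing_apply, D.f_adj, mul_neg, Finset.sum_neg_distrib] at this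
  rw [G', G', ← neg_mul, ← this]
  simp only [Finset.sum_mul, mul_assoc, (D.commute_f_Q _ q p).eq]
  simp only [← mul_assoc, D.ι_mul_Q h]

theorem G_bracket {q p : Fin n} (h : q ≠ p) : D.G' q * D.G' p - D.G' p * D.G' q =
    D.G' p * (D.P (Equiv.swap q p) - D.Q q p) - (D.P (Equiv.swap q p) - D.Q q p) * D.G' p := by
  -- the bracket of `f X` with the Casimir sum is the bracket of `ι_p (X - adj X)` with it
  have key (X : EndN G) : D.f X * D.G' p - D.G' p * D.f X =
      D.G' p * D.ι p (X - adj G X) - D.ι p (X - adj G X) * D.G' p := by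
    have h1 := sum_casimir_mul_right (D.pairing p D.f) (X - adj G X)
    have h2 := sum_casimir_mul_left (D.pairing p D.f) (X - adj G X)
    simp only [pairing_apply] at h1 h2
    have h3 : D.f X * D.G' p - D.G' p * D.f X =
        ∑ i, ∑ j, D.ι p (E i j) * (D.f X * D.f (E j i) - D.f (E j i) * D.f X) := by
      simp only [G', Finset.mul_sum, Finset.sum_mul, ← Finset.sum_sub_distrib, mul_sub]
      simp only [← mul_assoc, (D.f_commute X p _).eq]
    have h4 : D.G' p * D.ι p (X - adj G X) =
        ∑ i, ∑ j, D.ι p (E i j * (X - adj G X)) * D.f (E j i) := by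
      simp only [G', Finset.sum_mul, mul_assoc, (D.f_commute _ p _).eq, map_mul]
    have h5 : D.ι p (X - adj G X) * D.G' p =
        ∑ i, ∑ j, D.ι p ((X - adj G X) * E i j) * D.f (E j i) := by
      simp only [G', Finset.mul_sum, ← mul_assoc, map_mul]
    rw [h3, h4, h5, h1, h2]
    simp only [D.f_bracket, map_sub, mul_sub, Finset.sum_sub_distrib]
  have hc (X : EndN G) : Commute (D.ι q X) (D.G' p) :=
    .sum_right _ _ _ fun _ _ => .sum_right _ _ _ fun _ _ =>
      (D.ι_commute h _ _).mul_right (D.f_commute _ _ _).symm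
  have hL : D.G' q * D.G' p - D.G' p * D.G' q =
      ∑ i, ∑ j, D.ι q (E i j) * (D.f (E j i) * D.G' p - D.G' p * D.f (E j i)) := by
    rw [G']
    simp only [Finset.mul_sum, Finset.sum_mul, mul_sub, Finset.sum_sub_distrib, ← mul_assoc,
      (hc _).eq]
  have hPQ : D.P (Equiv.swap q p) - D.Q q p =
      ∑ i, ∑ j, D.ι q (E i j) * D.ι p (E j i - adj G (E j i)) := by
    simp only [D.P_swap h, Q, map_sub, mul_sub, Finset.sum_sub_distrib]
  rw [hL, hPQ]
  simp only [key, Finset.mul_sum, Finset.sum_mul, mul_sub, Finset.sum_sub_distrib, ← mul_assoc,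
    (hc _).eq]

/-- The reflection data attached to tensor data. -/
def toReflectionData {K : Type*} [Field K] [Algebra K A] [Algebra ℂ K] [IsScalarTower ℂ K A] :
    ReflectionData (Fin n) K A where
  P := D.P
  Q := D.Q
  G := D.G'
  eta := algebraMap ℂ K (eta G)
  eta_sq := by rw [← map_ofNat (algebraMap ℂ K) 2, ← map_mul, ← map_pow, two_mul_eta_sq, map_one]
  P_mul_Q := D.P_mul_Q
  P_mul_G := D.P_mul_G
  Q_symm _ _ h := D.Q_symm h
  Q_mul_Q _ _ _ h1 h2 h3 := D.Q_mul_Q h1 h2 h3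
  P_mul_Q_self _ _ h := by
    rw [D.P_mul_Q_self h, ← map_ofNat (algebraMap ℂ K) 2, ← map_mul, algebraMap_smul]
  Q_commute _ _ _ _ h1 h2 h3 h4 :=
    .sum_left _ _ _ fun _ _ => .sum_left _ _ _ fun _ _ =>
      (D.commute_ι_Q h1 h2 _).mul_left (D.commute_ι_Q h3 h4 _)
  G_commute_Q _ _ _ h1 h2 :=
    .sum_left _ _ _ fun _ _ => .sum_left _ _ _ fun _ _ =>
      (D.commute_ι_Q h1 h2 _).mul_left (D.commute_f_Q _ _ _)
  Q_mul_G _ _ h := D.Q_mul_G h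
  G_mul_Q _ _ h := D.G_mul_Q h
  G_bracket _ _ h := D.G_bracket h

end TensorData

/-! ### The algebra `End(ℂ^N)^{⊗ n} ⊗ U(𝔤)(u)` -/

section Concrete

variable (G : ClassicalGroup) (n : ℕ)

/-- `y ↦ y ⊗ 1`. -/
def includeEnd : EndTensor G n →ₐ[ℂ] Alg G n := Algebra.TensorProduct.includeLeft

/-- `z ↦ 1 ⊗ z`. -/
def includeUg : UgRat G →ₐ[ℂ] Alg G n := Algebra.TensorProduct.includeRight

/-- The scalar rational functions of `u` in `U(𝔤)(u)`. -/
def includeRat : RatFunc ℂ →ₐ[ℂ] UgRat G := Algebra.TensorProduct.includeRight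

/-- Together with `algAlgebra`, a shortcut for instance search, which otherwise gets stuck on the
ring structure of the tensor product. -/
instance algRing : Ring (Alg G n) := inferInstance

instance algAlgebra : Algebra ℂ (Alg G n) := inferInstance

variable {G n}

theorem tmul_eq (y : EndTensor G n) (z : UgRat G) :
    (y ⊗ₜ[ℂ] z : Alg G n) = includeEnd G n y * includeUg G n z := by
  have h : includeEnd G n y * includeUg G n z = (y * 1) ⊗ₜ[ℂ] (1 * z) :=
    Algebra.TensorProduct.tmul_mul_tmul y 1 1 z
  rw [h, mul_one, one_mul]

theorem includeEnd_commute (y : EndTensor G n) (z : UgRat G) :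
    Commute (includeEnd G n y) (includeUg G n z) := by
  have h : includeUg G n z * includeEnd G n y = (1 * y) ⊗ₜ[ℂ] (z * 1) :=
    Algebra.TensorProduct.tmul_mul_tmul 1 y z 1
  rw [Commute, SemiconjBy, h, mul_one, one_mul, tmul_eq]

theorem includeRat_commute (x : RatFunc ℂ) (z : UgRat G) : Commute (includeRat G x) z := by
  induction z using TensorProduct.induction_on with
  | zero => exact Commute.zero_right _
  | add a b ha hb => exact ha.add_right hb
  | tmul a b =>
    have h1 : includeRat G x * a ⊗ₜ[ℂ] b = (1 * a) ⊗ₜ[ℂ] (x * b) :=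
      Algebra.TensorProduct.tmul_mul_tmul 1 a x b
    have h2 : a ⊗ₜ[ℂ] b * includeRat G x = (a * 1) ⊗ₜ[ℂ] (b * x) :=
      Algebra.TensorProduct.tmul_mul_tmul a 1 b x
    rw [Commute, SemiconjBy, h1, h2, one_mul, mul_one, mul_comm]

theorem alg_induction {motive : Alg G n → Prop} (x : Alg G n)
    (h : ∀ y z, motive (includeEnd G n y * includeUg G n z))
    (hadd : ∀ a b, motive a → motive b → motive (a + b)) : motive x := by
  induction x using TensorProduct.induction_on with
  | zero =>
    have h0 := h 0 0
    have h1 : includeEnd G n 0 * includeUg G n 0 = 0 := by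
      rw [map_zero]
      exact @zero_mul (Alg G n) _ _
    rw [h1] at h0
    exact h0
  | add a b ha hb => exact hadd a b ha hb
  | tmul y z =>
    rw [tmul_eq]
    exact h y z

/-- The rational functions of `u` are central. -/
instance algAlgebraRatFunc : Algebra (RatFunc ℂ) (Alg G n) :=
  ((includeUg G n).toRingHom.comp (includeRat G).toRingHom).toAlgebra' fun c x => by
    change includeUg G n (includeRat G c) * x = x * includeUg G n (includeRat G c)
    induction x using alg_induction with
    | h y z =>
      rw [← mul_assoc, ← (includeEnd_commute y _).eq, mul_assoc, mul_assoc, ← map_mul, ← map_mul,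
        (includeRat_commute c z).eq]
    | hadd a b ha hb => rw [mul_add, add_mul, ha, hb]

theorem algebraMap_rat (x : RatFunc ℂ) :
    algebraMap (RatFunc ℂ) (Alg G n) x = includeUg G n (includeRat G x) := rfl

instance : IsScalarTower ℂ (RatFunc ℂ) (Alg G n) := by
  refine .of_algebraMap_eq fun c => ?_
  rw [algebraMap_rat, AlgHom.commutes, AlgHom.commutes]

/-- The linear map `A ↦ A - adj A` onto the Lie algebra, which sends `E_{ij}` to `F_{ij}`. -/
def toLie (G : ClassicalGroup) : EndN G →ₗ[ℂ] LieG G :=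
  (LinearMap.id - adj G).codRestrict (LieG G).toSubmodule fun A => by
    rw [eq_sum_E A]
    simp only [map_sum, map_smul]
    refine sum_mem fun i _ => sum_mem fun j _ => Submodule.smul_mem _ _ ?_
    simp only [LinearMap.sub_apply, LinearMap.id_apply, adj_E]
    exact F_mem G i j

theorem coe_toLie (A : EndN G) : (toLie G A : EndN G) = A - adj G A := rfl

theorem toLie_E (i j : Idx G) : toLie G (E i j) = F G i j :=
  Subtype.ext (by rw [coe_toLie, adj_E]; rfl)

theorem toLie_adj (A : EndN G) : toLie G (adj G A) = -toLie G A := by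
  apply Subtype.ext
  rw [coe_toLie, adj_adj, NegMemClass.coe_neg, coe_toLie, neg_sub]

theorem toLie_bracket (A B : EndN G) :
    ⁅toLie G A, toLie G B⁆ = toLie G ((A - adj G A) * B - B * (A - adj G A)) := by
  apply Subtype.ext
  rw [LieSubalgebra.coe_bracket, Ring.lie_def, coe_toLie, coe_toLie, coe_toLie]
  simp only [map_sub, adj_mul, adj_adj]
  noncomm_ring

/-- `A ↦ ι(A - adj A)`, as a map to the rational functions with values in `U(𝔤)`. -/
def toUgRat (G : ClassicalGroup) : EndN G →ₗ[ℂ] UgRat G where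
  toFun A := UniversalEnvelopingAlgebra.ι ℂ (toLie G A) ⊗ₜ[ℂ] (1 : RatFunc ℂ)
  map_add' A B := by
    rw [map_add, map_add]
    exact TensorProduct.add_tmul _ _ _
  map_smul' c A := by
    rw [map_smul, map_smul]
    exact (TensorProduct.smul_tmul' _ _ _).symm

theorem toUgRat_apply (A : EndN G) :
    toUgRat G A = UniversalEnvelopingAlgebra.ι ℂ (toLie G A) ⊗ₜ[ℂ] (1 : RatFunc ℂ) := rfl

theorem toUgRat_adj (A : EndN G) : toUgRat G (adj G A) = -toUgRat G A := by
  rw [toUgRat_apply, toLie_adj, map_neg]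
  exact TensorProduct.neg_tmul _ _

theorem toUgRat_bracket (A B : EndN G) :
    toUgRat G A * toUgRat G B - toUgRat G B * toUgRat G A =
      toUgRat G ((A - adj G A) * B - B * (A - adj G A)) := by
  have h (A B : EndN G) : toUgRat G A * toUgRat G B =
      (UniversalEnvelopingAlgebra.ι ℂ (toLie G A) * UniversalEnvelopingAlgebra.ι ℂ (toLie G B))
        ⊗ₜ[ℂ] (1 * 1 : RatFunc ℂ) := Algebra.TensorProduct.tmul_mul_tmul _ _ _ _
  rw [h, h, toUgRat_apply, ← toLie_bracket, LieHom.map_lie, LieRing.of_associative_ring_bracket,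
    mul_one]
  exact (TensorProduct.sub_tmul _ _ _).symm

variable (G n) in
/-- The operators of the theorem as tensor data. -/
def tensorData : TensorData G n (Alg G n) where
  ι p := (includeEnd G n).comp (iota G p)
  f := (includeUg G n).toLinearMap ∘ₗ toUgRat G
  P := ((includeEnd G n) : EndTensor G n →* Alg G n).comp (permHom G n)
  ι_commute h X Y := (iota_commute h X Y).map (includeEnd G n)
  f_commute X p Y := (includeEnd_commute _ _).symm
  f_adj X := by
    have h := congrArg (includeUg G n) (toUgRat_adj X)
    rw [map_neg] at h
    exact h
  f_bracket X Y := by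
    have h := congrArg (includeUg G n) (toUgRat_bracket X Y)
    rw [map_sub, map_mul, map_mul] at h
    exact h
  P_mul_ι σ p X := by
    change includeEnd G n (permOp G σ) * includeEnd G n (iota G p X) =
      includeEnd G n (iota G (σ p) X) * includeEnd G n (permOp G σ)
    rw [← map_mul, permOp_mul_iota, map_mul]
  P_mul_f σ X := (includeEnd_commute _ _)
  P_swap h := by
    change includeEnd G n (permOp G _) = ∑ i, ∑ j, includeEnd G n (iota G _ (E i j)) *
      includeEnd G n (iota G _ (E j i))
    simp only [permOp_swap h, map_sum, map_mul]

variable (G n) in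
/-- `tr^{⊗ n} ⊗ id`. It is recorded as an additive map, as its `ℂ`-linearity is used only for
scalars that are elements of the algebra. -/
def partialTrace : Alg G n →+ UgRat G :=
  AddMonoidHom.mk' (fun x => TensorProduct.lid ℂ (UgRat G) ((trTensor G n).rTensor (UgRat G) x))
    fun x y => by
      have h := ((TensorProduct.lid ℂ (UgRat G)).toLinearMap ∘ₗ
        (trTensor G n).rTensor (UgRat G)).map_add x y
      exact h

theorem partialTrace_tmul (y : EndTensor G n) (z : UgRat G) :
    partialTrace G n (y ⊗ₜ[ℂ] z) = trTensor G n y • z := rfl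

theorem partialTrace_mul_comm (y : EndTensor G n) (x : Alg G n) :
    partialTrace G n (includeEnd G n y * x) = partialTrace G n (x * includeEnd G n y) := by
  induction x using alg_induction with
  | h y' z =>
    rw [← mul_assoc, ← map_mul, mul_assoc, ← (includeEnd_commute y z).eq, ← mul_assoc, ← map_mul,
      ← tmul_eq, ← tmul_eq, partialTrace_tmul, partialTrace_tmul, trTensor_mul_comm]
  | hadd a b ha hb => rw [mul_add, add_mul, map_add, map_add, ha, hb]

theorem partialTrace_algebraMap_mul (c : ℂ) (x : Alg G n) :
    partialTrace G n (algebraMap ℂ (Alg G n) c * x) = c • partialTrace G n x := by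
  have h1 : algebraMap ℂ (Alg G n) c * x = c • x := (Algebra.smul_def c x).symm
  rw [h1]
  exact ((TensorProduct.lid ℂ (UgRat G)).toLinearMap ∘ₗ
        (trTensor G n).rTensor (UgRat G)).map_smul c x

theorem X_add_const_ne_zero (c : ℂ) :
    2 * (RatFunc.X : RatFunc ℂ) + algebraMap ℂ (RatFunc ℂ) c ≠ 0 := by
  have h : (2 * Polynomial.X + Polynomial.C c : Polynomial ℂ) ≠ 0 := by
    intro h
    simpa using congrArg (Polynomial.coeff · 1) h
  have h2 := (RatFunc.algebraMap_ne_zero h : algebraMap (Polynomial ℂ) (RatFunc ℂ) _ ≠ 0)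
  simpa [map_ofNat] using h2

theorem includeEnd_smul (c : ℂ) (y : EndTensor G n) :
    includeEnd G n (c • y) = algebraMap ℂ (Alg G n) c * includeEnd G n y := by
  have h : c • y = algebraMap ℂ (EndTensor G n) c * y := Algebra.smul_def c y
  rw [h, map_mul, AlgHom.commutes]

theorem groupRingOp_matrixElement {W : Type*} [NormedAddCommGroup W] [InnerProductSpace ℂ W]
    (ρ : Representation ℂ (Equiv.Perm (Fin n)) W) (w : W) :
    includeEnd G n (groupRingOp G (matrixElement ρ w)) =
      ∑ σ, algebraMap ℂ (Alg G n) ((Module.finrank ℂ W : ℂ) / (n.factorial : ℂ) *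
        inner ℂ w (ρ σ w)) * (tensorData G n).P σ := by
  have h (σ : Equiv.Perm (Fin n)) : (matrixElement ρ w).coeff σ =
      (Module.finrank ℂ W : ℂ) / (n.factorial : ℂ) * inner ℂ w (ρ σ w) := by
    rw [matrixElement, MonoidAlgebra.coeff_sum, Finsupp.finsetSum_apply]
    simp [MonoidAlgebra.coeff_single, Finsupp.single_apply]
  rw [groupRingOp, map_sum]
  refine Finset.sum_congr rfl fun σ _ => ?_
  rw [h]
  rw [includeEnd_smul]
  rfl

theorem Q_eq_includeEnd (q p : Fin n) : (tensorData G n).Q q p = includeEnd G n (Q G q p) := by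
  rw [TensorData.Q_eq, Q, map_sum]
  refine Finset.sum_congr rfl fun i _ => ?_
  rw [map_sum]
  refine Finset.sum_congr rfl fun j _ => ?_
  rw [includeEnd_smul, map_mul, Algebra.smul_def]
  rfl

theorem Fp_eq (p : Fin n) (x : RatFunc ℂ) :
    Fp G p x = (tensorData G n).toReflectionData.F p x := by
  have h1 : (1 : EndTensor G n) ⊗ₜ[ℂ] scalarRat G (-x - RatFunc.C (eta G)) =
      -algebraMap (RatFunc ℂ) (Alg G n) (x + algebraMap ℂ (RatFunc ℂ) (eta G)) := by
    rw [← map_neg, algebraMap_rat, tmul_eq, map_one, one_mul, neg_add, ← sub_eq_add_neg,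
      RatFunc.algebraMap_eq_C]
    rfl
  have h2 (i j : Idx G) :
      iota G p (E i j) ⊗ₜ[ℂ] (UniversalEnvelopingAlgebra.ι ℂ (F G j i) ⊗ₜ[ℂ] (1 : RatFunc ℂ)) =
        (tensorData G n).ι p (E i j) * (tensorData G n).f (E j i) := by
    rw [← toLie_E]
    exact tmul_eq _ _
  rw [Fp, h1]
  simp only [h2]
  rw [ReflectionData.F, sub_eq_add_neg, add_comm]
  rfl

theorem FT_eq {ν : YoungDiagram} (T : StandardTableau n ν)
    (Φ : MonoidAlgebra ℂ (Equiv.Perm (Fin n))) :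
    FT G T Φ = includeEnd G n (groupRingOp G Φ) *
      (tensorData G n).toReflectionData.sumProd (RatFunc.X : RatFunc ℂ)
        (fun p => (T.content p : ℂ)) (List.finRange n) := by
  rw [FT, ReflectionData.sumProd, List.ofFn_eq_map, tmul_eq, map_one, mul_one]
  congr 3
  funext p
  rw [Fp_eq, shifted, RatFunc.algebraMap_eq_C]
  congr 2
  rw [tmul_eq, (includeEnd_commute _ _).eq, Algebra.smul_def, algebraMap_rat, map_sum]
  congr 1
  exact Finset.sum_congr rfl fun q _ => (Q_eq_includeEnd q p).symm

theorem Z_eq_partialTrace {ν : YoungDiagram} (T : StandardTableau n ν)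
    (Φ : MonoidAlgebra ℂ (Equiv.Perm (Fin n))) : Z G T Φ = partialTrace G n (FT G T Φ) := by
  rw [Z, partialTrace, AddMonoidHom.mk'_apply]

/-- The trace depends only on the eigenvalues being the contents of a tableau and on the length of
the vector. -/
theorem Z_eq_of_isWeight {ν : YoungDiagram} {W : Type*} [NormedAddCommGroup W]
    [InnerProductSpace ℂ W] {ρ : Representation ℂ (Equiv.Perm (Fin n)) W} (hρ : ρ.IsIrreducible)
    (hinv : ∀ (σ : Equiv.Perm (Fin n)) (x y : W), inner ℂ (ρ σ x) (ρ σ y) = inner ℂ x y)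
    (T T' : StandardTableau n ν) {w w' : W}
    (hw : IsWeight ρ (fun p => (T.content p : ℂ)) w) (hw1 : inner ℂ w w = (1 : ℂ))
    (hw' : IsWeight ρ (fun p => (T'.content p : ℂ)) w') (hw1' : inner ℂ w' w' = (1 : ℂ)) :
    Z G T (matrixElement ρ w) = Z G T' (matrixElement ρ w') := by
  rw [Z_eq_partialTrace, Z_eq_partialTrace, FT_eq, FT_eq, groupRingOp_matrixElement,
    groupRingOp_matrixElement]
  have key := trace_sum_mul_sumProd_eq (tensorData G n).toReflectionData hρ hinv
    X_add_const_ne_zero (partialTrace G n) partialTrace_algebraMap_mul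
    (fun σ x => partialTrace_mul_comm (permOp G σ) x) hw hw' hw1 hw1'
    ((Module.finrank ℂ W : ℂ) / (n.factorial : ℂ))
  exact key

end Concrete

/-! ### Fillings of a Young diagram -/

-- The boxes of a diagram are indexed by `α`; `r` and `c` are the row and the column of a box.
section Filling

variable {α : Type*} [Fintype α] {r c : α → ℕ}

theorem card_left_eq (hinj : ∀ i j, r i = r j → c i = c j → i = j)
    (hlow : ∀ i a b, a ≤ r i → b ≤ c i → ∃ j, r j = a ∧ c j = b) (i : α) :
    (Finset.univ.filter fun j => r j = r i ∧ c j < c i).card = c i := by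
  rw [← Finset.card_range (c i)]
  refine Finset.card_nbij c (fun j hj => ?_) (fun j hj k hk h => ?_) fun b hb => ?_
  · simpa using (Finset.mem_filter.1 hj).2.2
  · have hj' := (Finset.mem_filter.1 hj).2
    have hk' := (Finset.mem_filter.1 hk).2
    exact hinj j k (hj'.1.trans hk'.1.symm) h
  · have hb' : b < c i := by simpa using hb
    obtain ⟨j, hj, rfl⟩ := hlow i _ b le_rfl hb'.le
    exact ⟨j, by simpa using ⟨hj, hb'⟩, rfl⟩

/-- The number of ordered pairs of boxes in the same row: an unequal pair is counted at its right
box `i`, which has `c i` boxes on its left. -/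
theorem sum_row_eq (hinj : ∀ i j, r i = r j → c i = c j → i = j)
    (hlow : ∀ i a b, a ≤ r i → b ≤ c i → ∃ j, r j = a ∧ c j = b) :
    (∑ i, ∑ j, if r i = r j then (1 : ℂ) else 0) = Fintype.card α + 2 * ∑ i, (c i : ℂ) := by
  classical
  have h1 (i : α) : (∑ j, if r j = r i ∧ c j < c i then (1 : ℂ) else 0) = c i := by
    rw [Finset.sum_boole, card_left_eq hinj hlow]
  have h2 : (∑ i, ∑ j, if r i = r j ∧ c i < c j then (1 : ℂ) else 0) = ∑ i, (c i : ℂ) := by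
    rw [Finset.sum_comm]
    exact Finset.sum_congr rfl fun i _ => h1 i
  have h3 (i j : α) : (if r i = r j then (1 : ℂ) else 0) = (if i = j then 1 else 0) +
      (if r j = r i ∧ c j < c i then 1 else 0) + (if r i = r j ∧ c i < c j then 1 else 0) := by
    by_cases hr : r i = r j
    · rcases lt_trichotomy (c i) (c j) with h | h | h
      · have : i ≠ j := by rintro rfl; exact lt_irrefl _ h
        simp [hr, h, h.not_gt, this]
      · simp [hinj i j hr h]
      · have : i ≠ j := by rintro rfl; exact lt_irrefl _ h
        simp [hr, h, h.not_gt, this]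
    · have : i ≠ j := by rintro rfl; exact hr rfl
      simp [hr, this, Ne.symm hr]
  simp only [h3, Finset.sum_add_distrib, h1, h2, Finset.sum_ite_eq, Finset.mem_univ, if_true,
    Finset.sum_const, Finset.card_univ, nsmul_eq_mul, mul_one]
  ring

/-- An arrangement of distinct boxes which has the row lengths and the columns of a Young diagram
covers the diagram: in each row, at most as many boxes lie in the first `k` columns as for the
diagram, while the totals over all rows agree. -/
theorem exists_box_of_card_eq {r' : α → ℕ}
    (hlow : ∀ i a b, a ≤ r i → b ≤ c i → ∃ j, r j = a ∧ c j = b)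
    (hcard : ∀ a, (Finset.univ.filter fun i => r' i = a).card =
      (Finset.univ.filter fun i => r i = a).card)
    (hinj' : ∀ i j, r' i = r' j → c i = c j → i = j) (i : α) : ∃ j, r' j = r i ∧ c j = c i := by
  classical
  set f : ℕ → ℕ → ℕ := fun a k => (Finset.univ.filter fun i => r' i = a ∧ c i < k).card with hf
  set g : ℕ → ℕ → ℕ := fun a k => (Finset.univ.filter fun i => r i = a ∧ c i < k).card with hg
  have hle (a k : ℕ) : f a k ≤ g a k := by
    by_cases h : ∃ j, r j = a ∧ k ≤ c j
    · obtain ⟨j, rfl, hj⟩ := h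
      have h1 : f (r j) k ≤ (Finset.range k).card := by
        refine Finset.card_le_card_of_injOn c (fun x hx => ?_) fun x hx y hy hxy => ?_
        · simpa using (Finset.mem_filter.1 hx).2.2
        · have hx' := (Finset.mem_filter.1 hx).2
          have hy' := (Finset.mem_filter.1 hy).2
          exact hinj' x y (hx'.1.trans hy'.1.symm) hxy
      refine h1.trans ((Finset.card_le_card fun b hb => ?_).trans (Finset.card_image_le (f := c)))
      have hb' : b < k := by simpa using hb
      obtain ⟨x, hx, rfl⟩ := hlow j _ b le_rfl (hb'.le.trans hj)
      exact Finset.mem_image_of_mem _ (by simpa using ⟨hx, hb'⟩)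
    · push Not at h
      calc f a k ≤ (Finset.univ.filter fun i => r' i = a).card :=
            Finset.card_le_card fun x hx => by
              simpa using (Finset.mem_filter.1 hx).2.1
        _ = (Finset.univ.filter fun i => r i = a).card := hcard a
        _ ≤ g a k := Finset.card_le_card fun x hx => by
              have hx' : r x = a := by simpa using hx
              simpa using ⟨hx', h x hx'⟩
  set A : Finset ℕ := Finset.univ.image r ∪ Finset.univ.image r' with hA
  have hsum (s : α → ℕ) (hs : ∀ i, s i ∈ A) (k : ℕ) :
      ∑ a ∈ A, (Finset.univ.filter fun i => s i = a ∧ c i < k).card =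
        (Finset.univ.filter fun i => c i < k).card := by
    rw [Finset.card_eq_sum_card_fiberwise (f := s) (t := A) fun i _ => hs i]
    refine Finset.sum_congr rfl fun a _ => ?_
    rw [Finset.filter_filter]
    simp only [and_comm]
  have heq (k : ℕ) : ∀ a ∈ A, f a k = g a k :=
    (Finset.sum_eq_sum_iff_of_le fun a _ => hle a k).1 (by
      rw [hf, hg]
      simp only
      rw [hsum r' (fun i => by simp [hA]) k, hsum r (fun i => by simp [hA]) k])
  have hi : r i ∈ A := by simp [hA]
  have hlt : g (r i) (c i) < g (r i) (c i + 1) := by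
    refine Finset.card_lt_card (Finset.ssubset_iff_of_subset ?_ |>.2 ⟨i, by simp, by simp⟩)
    intro x hx
    have hx' := (Finset.mem_filter.1 hx).2
    simpa using ⟨hx'.1, hx'.2.le⟩
  rw [← heq _ _ hi, ← heq _ _ hi] at hlt
  obtain ⟨j, hj, hj'⟩ := Finset.exists_mem_notMem_of_card_lt_card hlt
  have h1 := (Finset.mem_filter.1 hj).2
  have h2 : ¬ c j < c i := fun h => hj' (by simpa using ⟨h1.1, h⟩)
  exact ⟨j, h1.1, by omega⟩

/-- An arrangement of distinct boxes `(r', c)` with the row lengths and the columns of a diagram is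
closed under passing to the left and up. -/
theorem exists_box_of_le {r' : α → ℕ} (hinj : ∀ i j, r i = r j → c i = c j → i = j)
    (hlow : ∀ i a b, a ≤ r i → b ≤ c i → ∃ j, r j = a ∧ c j = b)
    (hcard : ∀ a, (Finset.univ.filter fun i => r' i = a).card =
      (Finset.univ.filter fun i => r i = a).card)
    (hinj' : ∀ i j, r' i = r' j → c i = c j → i = j) (i : α) {a b : ℕ} (ha : a ≤ r' i)
    (hb : b ≤ c i) : ∃ j, r' j = a ∧ c j = b := by
  choose s hs using exists_box_of_card_eq hlow hcard hinj'
  have hs_inj : Function.Injective s := fun x y h => by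
    have hx := hs x
    rw [h, (hs y).1, (hs y).2] at hx
    exact (hinj y x hx.1 hx.2).symm
  obtain ⟨x, rfl⟩ := (Finite.injective_iff_surjective.1 hs_inj) i
  obtain ⟨y, rfl, rfl⟩ := hlow x a b (ha.trans (hs x).1.le) (hb.trans (hs x).2.le)
  exact ⟨s y, hs y⟩

end Filling

/-! ### The sum of the transpositions on an irreducible representation -/

section Transpositions

variable {p : ℕ} {V : Type*} [AddCommGroup V] [Module ℂ V]
  {ρ : Representation ℂ (Equiv.Perm (Fin p)) V}

/-- The action of `∑_{i,j} (i j)`, where `(i i) = 1`: twice the sum of the transpositions,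
plus `p`. -/
def swapSum (ρ : Representation ℂ (Equiv.Perm (Fin p)) V) : V →ₗ[ℂ] V :=
  ∑ i, ∑ j, ρ (Equiv.swap i j)

theorem swapSum_apply (x : V) : swapSum ρ x = ∑ i, ∑ j, ρ (Equiv.swap i j) x := by
  simp [swapSum]

theorem swapSum_comm (σ : Equiv.Perm (Fin p)) (x : V) :
    swapSum ρ (ρ σ x) = ρ σ (swapSum ρ x) := by
  rw [swapSum_apply, swapSum_apply, map_sum]
  symm
  refine Fintype.sum_equiv σ _ _ fun i => ?_
  rw [map_sum]
  refine Fintype.sum_equiv σ _ _ fun j => ?_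
  rw [← Module.End.mul_apply, ← map_mul, ← Module.End.mul_apply, ← map_mul,
    Equiv.mul_swap_eq_swap_mul]

theorem eq_zero_of_eq_neg {x : V} (h : x = -x) : x = 0 := by
  have h2 : (2 : ℂ) • x = 0 := by rw [two_smul, ← sub_neg_eq_add, ← h, sub_self]
  exact (smul_eq_zero.1 h2).resolve_left two_ne_zero

open Classical in
/-- The column antisymmetrizer, for columns given by a function `c`. -/
def antisymmetrizer (ρ : Representation ℂ (Equiv.Perm (Fin p)) V) (c : Fin p → ℕ) : V →ₗ[ℂ] V :=
  ∑ σ : Equiv.Perm (Fin p) with ∀ q, c (σ q) = c q, ((Equiv.Perm.sign σ : ℤ) : ℂ) • ρ σ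

open Classical in
theorem antisymmetrizer_apply (c : Fin p → ℕ) (x : V) : antisymmetrizer ρ c x =
    ∑ σ : Equiv.Perm (Fin p) with ∀ q, c (σ q) = c q, ((Equiv.Perm.sign σ : ℤ) : ℂ) • ρ σ x := by
  simp [antisymmetrizer]

theorem swapSum_antisymmetrizer (c : Fin p → ℕ) (x : V) :
    swapSum ρ (antisymmetrizer ρ c x) = antisymmetrizer ρ c (swapSum ρ x) := by
  simp only [antisymmetrizer_apply, map_sum, map_smul, swapSum_comm]

theorem antisymmetrizer_swap {c : Fin p → ℕ} {i j : Fin p} (h : c i = c j) (hij : i ≠ j) (x : V) :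
    antisymmetrizer ρ c (ρ (Equiv.swap i j) x) = -antisymmetrizer ρ c x := by
  classical
  have hc (q : Fin p) : c (Equiv.swap i j q) = c q := by
    rcases eq_or_ne q i with rfl | h1
    · rw [Equiv.swap_apply_left, h]
    rcases eq_or_ne q j with rfl | h2
    · rw [Equiv.swap_apply_right, h]
    rw [Equiv.swap_apply_of_ne_of_ne h1 h2]
  rw [antisymmetrizer_apply, antisymmetrizer_apply, ← Finset.sum_neg_distrib]
  refine Finset.sum_equiv (Equiv.mulRight (Equiv.swap i j)) (fun σ => ?_) fun σ _ => ?_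
  · simp only [Finset.mem_filter, Finset.mem_univ, true_and, Equiv.coe_mulRight,
      Equiv.Perm.mul_apply]
    refine ⟨fun h q => by rw [h, hc], fun h q => ?_⟩
    have := h (Equiv.swap i j q)
    rwa [Equiv.swap_apply_self, hc] at this
  · change _ = -(((Equiv.Perm.sign (σ * Equiv.swap i j) : ℤ) : ℂ) • ρ (σ * Equiv.swap i j) x)
    rw [map_mul ρ, Module.End.mul_apply, Equiv.Perm.sign_mul, Equiv.Perm.sign_swap hij]
    simp

theorem antisymmetrizer_ne_zero {c : Fin p → ℕ} {v : V} (hv : v ≠ 0)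
    (h : ∀ σ : Equiv.Perm (Fin p), (∀ q, c (σ q) = c q) →
      ρ σ v = ((Equiv.Perm.sign σ : ℤ) : ℂ) • v) : antisymmetrizer ρ c v ≠ 0 := by
  classical
  have h1 : antisymmetrizer ρ c v =
      ((Finset.univ.filter fun σ : Equiv.Perm (Fin p) => ∀ q, c (σ q) = c q).card : ℂ) • v := by
    rw [antisymmetrizer_apply, Nat.cast_smul_eq_nsmul, ← Finset.sum_const]
    refine Finset.sum_congr rfl fun σ hσ => ?_
    rw [h σ (Finset.mem_filter.1 hσ).2, smul_smul, ← Int.cast_mul, ← Units.val_mul,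
      Int.units_mul_self]
    simp
  rw [h1]
  refine smul_ne_zero (Nat.cast_ne_zero.2 (Finset.card_ne_zero.2 ⟨1, ?_⟩)) hv
  simp

/-- If `x` is symmetric along rows, then the column antisymmetrizer turns the transpositions within
a row, applied to `x`, into `1`, those within a column into `-1`, and all others into `0`. -/
theorem antisymmetrizer_swap_of_symmetric {r c : Fin p → ℕ} {x : V}
    (hinj : ∀ i j, r i = r j → c i = c j → i = j)
    (hlow : ∀ i a b, a ≤ r i → b ≤ c i → ∃ j, r j = a ∧ c j = b)
    (hx : ∀ i j, r i = r j → ρ (Equiv.swap i j) x = x) (i j : Fin p) :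
    antisymmetrizer ρ c (ρ (Equiv.swap i j) x) =
      (((if i = j then 1 else 0) + (if r i = r j then 1 else 0) -
        (if c i = c j then 1 else 0) : ℂ)) • antisymmetrizer ρ c x := by
  rcases eq_or_ne i j with rfl | hij
  · simp [Equiv.swap_self, ← Equiv.Perm.one_def]
  by_cases hr : r i = r j
  · have hc : c i ≠ c j := fun h => hij (hinj i j hr h)
    rw [hx i j hr]
    simp [hij, hr, hc]
  by_cases hc : c i = c j
  · rw [antisymmetrizer_swap hc hij]
    simp [hij, hr, hc]
  have h0 : antisymmetrizer ρ c (ρ (Equiv.swap i j) x) = 0 := by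
    wlog h : r i < r j generalizing i j
    · rw [Equiv.swap_comm]
      exact this j i hij.symm (Ne.symm hr) (Ne.symm hc) (lt_of_le_of_ne (not_lt.1 h) (Ne.symm hr))
    -- the box in the row of `i` and the column of `j`
    obtain ⟨k, hk, hk'⟩ := hlow j (r i) (c j) h.le le_rfl
    have hkj : k ≠ j := fun e => hr (by rw [← hk, e])
    have hki : k ≠ i := fun e => hc (by rw [← hk', e])
    have h1 : ρ (Equiv.swap i j) x = ρ (Equiv.swap k j) (ρ (Equiv.swap i j) x) := by
      conv_lhs => rw [← hx k i hk, ← Module.End.mul_apply, ← map_mul, Equiv.mul_swap_eq_swap_mul,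
        Equiv.swap_apply_left, Equiv.swap_apply_of_ne_of_ne hki hkj, map_mul, Module.End.mul_apply]
    have h2 := antisymmetrizer_swap (ρ := ρ) hk' hkj (ρ (Equiv.swap i j) x)
    rw [← h1] at h2
    exact eq_zero_of_eq_neg h2
  rw [h0]
  simp [hij, hr, hc]

/-- The sum of the transpositions acts on an irreducible representation by the sum of the contents
of the boxes of the Young diagram; the factor `2` and the summand `p` come from `swapSum`. -/
theorem IsYoungIrrep.swapSum_eq {μ : YoungDiagram} (h : IsYoungIrrep μ ρ) (x : V) :
    swapSum ρ x = ((p : ℂ) + 2 * ∑ b ∈ μ.cells, ((b.2 : ℂ) - (b.1 : ℂ))) • x := by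
  obtain ⟨hirr, e, ⟨v, hv0, hv⟩, v', hv0', hv'⟩ := h
  set r : Fin p → ℕ := fun i => (e i).1.1 with hr
  set c : Fin p → ℕ := fun i => (e i).1.2 with hc
  have hinj (i j) (h1 : r i = r j) (h2 : c i = c j) : i = j :=
    e.injective (Subtype.ext (Prod.ext h1 h2))
  have hlow (i a b) (ha : a ≤ r i) (hb : b ≤ c i) : ∃ j, r j = a ∧ c j = b := by
    obtain ⟨j, hj⟩ := e.surjective ⟨(a, b), μ.isLowerSet (show (a, b) ≤ (e i).1 from ⟨ha, hb⟩)
      (e i).2⟩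
    exact ⟨j, by rw [hr]; simp [hj], by rw [hc]; simp [hj]⟩
  -- by irreducibility, some translate of the symmetric vector is not killed
  obtain ⟨g, hg⟩ : ∃ g, antisymmetrizer ρ c (ρ g v) ≠ 0 := by
    by_contra! hcon
    have hle : Submodule.span ℂ (Set.range fun g => ρ g v) ≤
        LinearMap.ker (antisymmetrizer ρ c) := by
      rw [Submodule.span_le]
      rintro _ ⟨g, rfl⟩
      exact hcon g
    rw [span_orbit_eq_top hirr hv0] at hle
    exact antisymmetrizer_ne_zero hv0' hv' (hle (Submodule.mem_top (x := v')))
  set y := ρ g v with hy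
  set r' : Fin p → ℕ := fun i => r (g⁻¹ i) with hr'
  have hsymm (i j) (hij : r' i = r' j) : ρ (Equiv.swap i j) y = y := by
    have h1 : Equiv.swap i j * g = g * Equiv.swap (g⁻¹ i) (g⁻¹ j) := by
      rw [Equiv.mul_swap_eq_swap_mul]
      simp
    rw [hy, ← Module.End.mul_apply, ← map_mul, h1, map_mul, Module.End.mul_apply, hv]
    intro q
    rcases eq_or_ne q (g⁻¹ i) with rfl | h2
    · rw [Equiv.swap_apply_left]; exact hij.symm
    rcases eq_or_ne q (g⁻¹ j) with rfl | h3
    · rw [Equiv.swap_apply_right]; exact hij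
    rw [Equiv.swap_apply_of_ne_of_ne h2 h3]
  have hinj' (i j) (h1 : r' i = r' j) (h2 : c i = c j) : i = j := by
    by_contra hij
    have h3 := antisymmetrizer_swap (ρ := ρ) h2 hij y
    rw [hsymm i j h1] at h3
    exact hg (eq_zero_of_eq_neg h3)
  have hcard (a : ℕ) : (Finset.univ.filter fun i => r' i = a).card =
      (Finset.univ.filter fun i => r i = a).card :=
    Finset.card_equiv g⁻¹ (by simp [hr'])
  have hlow' (i a b) (ha : a ≤ r' i) (hb : b ≤ c i) : ∃ j, r' j = a ∧ c j = b :=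
    exists_box_of_le hinj hlow hcard hinj' i ha hb
  refine apply_eq_smul_of_commute hirr _ swapSum_comm hg ?_ x
  rw [swapSum_antisymmetrizer, swapSum_apply]
  simp only [map_sum, antisymmetrizer_swap_of_symmetric hinj' hlow' hsymm, ← Finset.sum_smul]
  congr 1
  have hrow : (∑ i, ∑ j, if r' i = r' j then (1 : ℂ) else 0) =
      ∑ i, ∑ j, if r i = r j then (1 : ℂ) else 0 :=
    Fintype.sum_equiv g⁻¹ _ _ fun i => Fintype.sum_equiv g⁻¹ _ _ fun j => rfl
  have hrc := sum_row_eq hinj hlow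
  have hcr := sum_row_eq (r := c) (c := r) (fun i j h1 h2 => hinj i j h2 h1) fun i a b ha hb => by
    obtain ⟨j, h1, h2⟩ := hlow i b a hb ha
    exact ⟨j, h2, h1⟩
  have hcells : ∑ b ∈ μ.cells, ((b.2 : ℂ) - (b.1 : ℂ)) = ∑ i, (c i : ℂ) - ∑ i, (r i : ℂ) := by
    rw [← Finset.sum_coe_sort, ← Finset.sum_sub_distrib]
    exact (Fintype.sum_equiv e _ _ fun i => rfl).symm
  simp only [Finset.sum_sub_distrib, Finset.sum_add_distrib, hrow, hrc, hcr, hcells,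
    Finset.sum_ite_eq, Finset.mem_univ, if_true, Finset.sum_const, Finset.card_univ,
    Fintype.card_fin, nsmul_eq_mul, mul_one]
  ring

end Transpositions

/-! ### Young vectors -/

section YoungVector

variable {n : ℕ} {ν : YoungDiagram} {W : Type*} [AddCommGroup W] [Module ℂ W]
  {ρ : Representation ℂ (Equiv.Perm (Fin n)) W} {T : StandardTableau n ν} {w : W}

theorem permEmbed_swap {p : ℕ} (hp : p ≤ n) (i j : Fin p) :
    permEmbed hp (Equiv.swap i j) = Equiv.swap (Fin.castLE hp i) (Fin.castLE hp j) := by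
  have hι (i : Fin p) : Fin.castLEEmb hp i = Fin.castLE hp i := rfl
  ext1 q
  rw [permEmbed, Equiv.Perm.viaEmbeddingHom_apply]
  by_cases hq : q ∈ Set.range (Fin.castLEEmb hp)
  · obtain ⟨k, rfl⟩ := hq
    rw [Equiv.Perm.viaEmbedding_apply, hι, hι,
      ← (Fin.castLE_injective hp).map_swap]
  · rw [Equiv.Perm.viaEmbedding_apply_of_notMem _ _ _ hq, Equiv.swap_apply_of_ne_of_ne]
    · rintro rfl
      exact hq ⟨i, rfl⟩
    · rintro rfl
      exact hq ⟨j, rfl⟩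

theorem sum_castLE {M : Type*} [AddCommMonoid M] {p : ℕ} (hp : p ≤ n) (f : Fin n → M) :
    ∑ i : Fin p, f (Fin.castLE hp i) = ∑ i : Fin n with i.1 < p, f i := by
  refine Finset.sum_nbij (Fin.castLE hp) (by simp) (Fin.castLE_injective hp).injOn
    (fun i hi => ?_) fun _ _ => rfl
  have hi' : (i : ℕ) < p := by simpa using hi
  exact ⟨⟨i, hi'⟩, by simp, rfl⟩

/-- On a Young vector, the sum of the transpositions in `S_p` is the sum of the contents of the
boxes occupied by `1, …, p`. The sum here is over ordered pairs and contains `(i i) = 1`, whence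
the factor `2` and the summand `p`. -/
theorem IsYoungVector.sum_swap (hw : IsYoungVector ρ T w) {p : ℕ} (hp : p ≤ n) :
    ∑ i : Fin n with i.1 < p, ∑ j : Fin n with j.1 < p, ρ (Equiv.swap i j) w =
      ((p : ℂ) + 2 * ∑ i : Fin n with i.1 < p, (T.content i : ℂ)) • w := by
  obtain ⟨U, hU, hwU⟩ := hw p hp
  have h := congrArg Subtype.val (hU.swapSum_eq ⟨w, hwU⟩)
  have h1 (i j : Fin p) : ((U.toRepresentation (Equiv.swap i j) ⟨w, hwU⟩ : U.toSubmodule) : W) =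
      ρ (Equiv.swap (Fin.castLE hp i) (Fin.castLE hp j)) w := by
    rw [← permEmbed_swap]
    rfl
  have h2 : ∑ b ∈ (T.shape p).cells, ((b.2 : ℂ) - (b.1 : ℂ)) =
      ∑ i : Fin n with i.1 < p, (T.content i : ℂ) := by
    rw [StandardTableau.shape, Finset.sum_image fun i _ j _ h => T.box.injective (Subtype.ext h)]
    exact Finset.sum_congr rfl fun i _ => by simp [StandardTableau.content]
  rw [swapSum_apply, h2] at h
  simp only [AddSubmonoidClass.coe_finsetSum, h1, SetLike.val_smul] at h
  rw [← h, ← sum_castLE hp]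
  exact Finset.sum_congr rfl fun i _ =>
    (sum_castLE hp fun j => ρ (Equiv.swap (Fin.castLE hp i) j) w).symm

/-- A Young vector is a common eigenvector of the Jucys–Murphy elements, and the eigenvalues are the
contents: the `p`-th Jucys–Murphy element is the difference of the sums of the transpositions of
two consecutive symmetric groups. -/
theorem IsYoungVector.isWeight (hw : IsYoungVector ρ T w) :
    IsWeight ρ (fun p => (T.content p : ℂ)) w := by
  intro p
  have h1 := hw.sum_swap p.2.le
  have h2 := hw.sum_swap (Nat.succ_le_of_lt p.2)
  have hset : (Finset.univ.filter fun q : Fin n => q.1 < p.1 + 1) =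
      insert p (Finset.univ.filter fun q : Fin n => q < p) := by
    ext q
    simp only [Finset.mem_filter, Finset.mem_univ, true_and, Finset.mem_insert, Fin.lt_def,
      Fin.ext_iff]
    omega
  have hp : p ∉ Finset.univ.filter fun q : Fin n => q < p := by simp
  simp only [Nat.succ_eq_add_one, hset, Finset.sum_insert hp, Finset.sum_add_distrib] at h2
  simp only [← Fin.lt_def] at h1
  have hJ : ∑ q with q < p, ρ (Equiv.swap p q) w = jucysMurphy ρ p w := by
    rw [jucysMurphy_apply]
    exact Finset.sum_congr rfl fun q _ => by rw [Equiv.swap_comm]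
  rw [h1, hJ, ← jucysMurphy_apply, Equiv.swap_self, ← Equiv.Perm.one_def, map_one,
    Module.End.one_apply] at h2
  have h3 : (2 : ℂ) • jucysMurphy ρ p w = (2 : ℂ) • (T.content p : ℂ) • w := by
    have h4 : (2 : ℂ) • jucysMurphy ρ p w =
        (w + jucysMurphy ρ p w + (jucysMurphy ρ p w +
          ((p : ℂ) + 2 * ∑ i : Fin n with i < p, (T.content i : ℂ)) • w)) -
          (1 + (p : ℂ) + 2 * ∑ i : Fin n with i < p, (T.content i : ℂ)) • w := by
      module
    rw [h4]
    simp only [Nat.cast_add, Nat.cast_one] at h2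
    rw [h2]
    module
  exact smul_right_injective W two_ne_zero h3

end YoungVector

end Capelli

end

open Capelli in
theorem theorem2p7 (G : ClassicalGroup) (n : ℕ) (ν : YoungDiagram) (hν : ν.colLen 0 ≤ G.dim)
    {W : Type*} [NormedAddCommGroup W] [InnerProductSpace ℂ W]
    (ρ : Representation ℂ (Equiv.Perm (Fin n)) W) (hρ : IsYoungIrrep ν ρ)
    (hinv : ∀ (σ : Equiv.Perm (Fin n)) (x y : W), inner ℂ (ρ σ x) (ρ σ y) = inner ℂ x y)
    (T T' : StandardTableau n ν) (w w' : W)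
    (hw : IsYoungVector ρ T w) (hw1 : inner ℂ w w = (1 : ℂ))
    (hw' : IsYoungVector ρ T' w') (hw1' : inner ℂ w' w' = (1 : ℂ)) :
    Z G T (matrixElement ρ w) = Z G T' (matrixElement ρ w') := by
  exact Z_eq_of_isWeight hρ.1 hinv T T' hw.isWeight hw1 hw'.isWeight hw1'
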